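/- Fix $n\ge 1$ and let $\mathbb F_n^+$ be the free semigroup of words in $g_1,\dots,g_n$, with empty word $g_0$. For a tuple $X=(X_1,\dots,X_n)$ and $\alpha=g_{i_1}\cdots g_{i_k}$ write $X_\alpha=X_{i_1}\cdots X_{i_k}$ and $X_{g_0}=I$. For $X\in B(\mathcal H)^n$ put $\|X\|=\|\sum_i X_iX_i^*\|^{1/2}$ and $[B(\mathcal H)^n]_\gamma=\{X:\|X\|<\gamma\}$. Let $Z_1,\dots,Z_n$ be noncommuting indeterminates. For a formal power series $G=\sum_\alpha a_\alpha Z_\alpha$ over $\mathbb C$, the radius of convergence $r(G)$ is given by $r(G)^{-1}=\limsup_k(\sum_{|\alpha|=k}|a_\alpha|^2)^{1/2k}$, and $G(X)=\sum_k\sum_{|\alpha|=k}a_\alpha X_\alpha$ (a series in $k$). *Evaluations.* Let $f=(f_1,\dots,f_n)$ be a tuple of power series. A tuple $X$ is in the SOT convergence set of $f$, with value $f(X)$, if every series $f_j(X)$ converges in the strong operator topology. It is in the radial convergence set of $f$ if, for some $\delta\in(0,1)$, all $f_j(rX)$ converge in norm for $r\in(\delta,1)$ and $f_j(X):=\text{SOT-}\lim_{r\to1}f_j(rX)$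 exists for all $j$. *The space.* $H^2(f)$ is the Hilbert space with orthonormal basis $\{f_\alpha\}_{\alpha\in\mathbb F_n^+}$, i.e. the completion of $\operatorname{span}\{f_\alpha\}$ for $\langle f_\alpha,f_\beta\rangle=\delta_{\alpha\beta}$. Its elements $\sum_\alpha a_\alpha f_\alpha$, $\sum_\alpha|a_\alpha|^2<\infty$, are regarded as formal power series in case (S) below and as functions $X\mapsto\sum_\alpha a_\alpha[f(X)]_\alpha$ on $[B(\mathcal K)^n]_\gamma$, $\mathcal K$ separable and infinite dimensional, in case (F). $M_\psi$ denotes left multiplication by $\psi$ on $H^2(f)$ (in case (A), the continuous extension of multiplication on polynomials). *Model property.* $f$ has the model property if one of the following holds. (A) $f$ is a tuple of noncommutative polynomials that has an inverse, with respect to composition, which is a tuple of polynomials. (S) $f$ is a tuple of formal power series with $f(0)=0$, with nonzero radius of convergence and with $\det[\text{coefficient of }Z_j\text{ in }f_i]_{i,j}\ne0$; each $Z_i$ lies in $H^2(f)$ and $M_{Z_i}$ is a bounded operator on $H^2(f)$; and $(M_{Z_1},\dots,M_{Z_n})$ is in the SOT or in the radial convergence set of $f$, with $f_j(M_{Z_1},\dots,M_{Z_n})=M_{f_j}$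 for all $j$. (F) For some $\gamma>0$, $f$ is a tuple of free holomorphic functions on $[B(\mathcal K)^n]_\gamma$ (power series with $r(f_j)\ge\gamma$) with range in $[B(\mathcal K)^n]_1$; $G\circ f\ne0$ for every nonzero free holomorphic function $G$ on $[B(\mathcal K)^n]_1$; each coordinate function $X_i$ lies in $H^2(f)$ and $M_{Z_i}$, left multiplication by $X_i$, is a bounded operator on $H^2(f)$; and $(M_{Z_1},\dots,M_{Z_n})$ is in the SOT or in the radial convergence set of $f$, with $f_j(M_{Z_1},\dots,M_{Z_n})=M_{f_j}$ for all $j$. *Domain.* Let $g=(g_1,\dots,g_n)$ be the inverse of $f$, i.e. the tuple with $g\circ f=\mathrm{id}$: a tuple of polynomials in case (A), of formal power series in case (S), of free holomorphic functions on $[B(\mathcal K)^n]_1$ with $g(f(X))=X$ for $X\in[B(\mathcal K)^n]_\gamma$ in case (F). For a complex Hilbert space $\mathcal H$, $\mathbb B_f(\mathcal H)$ is the set of $X\in B(\mathcal H)^n$ in the SOT or the radial convergence set of $f$ such that $\|f(X)\|\le1$, $f(X)$ is in the SOT or the radial convergence set of $g$, and $g(f(X))=X$. An element $X$ of $\mathbb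 B_f(\mathcal H)$ is pure if $\text{SOT-}\lim_{k}\sum_{|\alpha|=k}[f(X)]_\alpha[f(X)]_\alpha^*=0$. **Theorem.** Let $f$ have the model property, let $\mathcal H$ be a complex Hilbert space and $T\in B(\mathcal H)^n$. (1) $T$ is a pure element of $\mathbb B_f(\mathcal H)$ if and only if there are a Hilbert space $\mathcal D$ and a closed subspace $\mathcal M\subseteq H^2(f)\otimes\mathcal D$, invariant under each $(M_{Z_i}\otimes I_{\mathcal D})^*$, such that $T$ is unitarily equivalent to $(P_{\mathcal M}(M_{Z_1}\otimes I_{\mathcal D})|_{\mathcal M},\dots,P_{\mathcal M}(M_{Z_n}\otimes I_{\mathcal D})|_{\mathcal M})$. (2) If $T$ is a pure element of $\mathbb B_f(\mathcal H)$, $\Delta=(I-\sum_j f_j(T)f_j(T)^*)^{1/2}$ and $\mathcal D_{f,T}=\overline{\Delta\mathcal H}$, then the noncommutative Poisson kernel $K_{f,T}:\mathcal H\to H^2(f)\otimes\mathcal D_{f,T}$, $K_{f,T}h=\sum_\alpha f_\alpha\otimes\Delta[f(T)]_\alpha^*h$, is a well-defined isometry and $K_{f,T}T_i^*=(M_{Z_i}^*\otimes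 I)K_{f,T}$ for $i=1,\dots,n$. -/

import Mathlib

open Filter Topology
open scoped TensorProduct

universe u

noncomputable section

namespace NCModel

/-! ### Noncommutative formal power series -/

/-- The free semigroup `𝔽ₙ⁺` with generators `g₁, …, gₙ`: a word is the list of its letters. -/
abbrev Word (n : ℕ) : Type := List (Fin n)

/-- Formal power series `∑ a_α Z_α` in `n` noncommuting indeterminates, given by the
coefficients `α ↦ a_α`. -/
abbrev NCSeries (n : ℕ) : Type := Word n → ℂ

/-- A noncommutative polynomial is a power series with finitely many nonzero coefficients. -/
def IsPolynomial {n : ℕ} (G : NCSeries n) : Prop := G.support.Finite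

/-- The series `I`. -/
def oneSeries (n : ℕ) : NCSeries n := fun β => if β = [] then 1 else 0

/-- The indeterminate `Z_i`. -/
def Z {n : ℕ} (i : Fin n) : NCSeries n := fun β => if β = [i] then 1 else 0

/-- The product of two power series: `(F G)_β = ∑_{στ = β} F_σ G_τ`. -/
def mulSeries {n : ℕ} (F G : NCSeries n) : NCSeries n :=
  fun β => ∑ k ∈ Finset.range (β.length + 1), F (β.take k) * G (β.drop k)

/-- `f_α = f_{i₁} ⋯ f_{i_k}` for `α = g_{i₁} ⋯ g_{i_k}`, with `f_{g₀} = I`. -/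
def wordSeries {n : ℕ} (f : Fin n → NCSeries n) : Word n → NCSeries n
  | [] => oneSeries n
  | i :: α => mulSeries (f i) (wordSeries f α)

/-- The formal composition `G ∘ f = ∑_α G_α f_α`. It is used only when `G` is a polynomial or
`f(0) = 0`; in both cases every coefficient is a finite sum. -/
def comp {n : ℕ} (G : NCSeries n) (f : Fin n → NCSeries n) : NCSeries n :=
  fun β => ∑ᶠ α : Word n, G α * wordSeries f α β

/-- The reciprocal of the radius of convergence,
`r(G)⁻¹ = limsup_k (∑_{|α| = k} |a_α|²)^{1/2k}`. -/
def invRadius {n : ℕ} (G : NCSeries n) : ENNReal :=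
  limsup (fun k : ℕ => ENNReal.ofReal
    ((∑ w : Fin k → Fin n, ‖G (List.ofFn w)‖ ^ 2) ^ (1 / (2 * (k : ℝ))))) atTop

/-- The Jacobian matrix `J_f(0)`, whose `(i, j)` entry is the coefficient of `Z_j` in `f_i`. -/
def jacobianZero {n : ℕ} (f : Fin n → NCSeries n) : Matrix (Fin n) (Fin n) ℂ :=
  Matrix.of fun i j => f i [j]

/-! ### Evaluation at tuples of operators -/

section Evaluation

variable {n : ℕ} {H : Type*} [NormedAddCommGroup H] [InnerProductSpace ℂ H]

/-- `X_α = X_{i₁} ⋯ X_{i_k}`. -/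
def opWord (X : Fin n → H →L[ℂ] H) (α : Word n) : H →L[ℂ] H := (α.map X).prod

/-- The homogeneous part `∑_{|α| = k} a_α X_α`. -/
def homPart (G : NCSeries n) (X : Fin n → H →L[ℂ] H) (k : ℕ) : H →L[ℂ] H :=
  ∑ w : Fin k → Fin n, G (List.ofFn w) • opWord X (List.ofFn w)

/-- The partial sum `∑_{k < N} ∑_{|α| = k} a_α X_α`. -/
def partialSum (G : NCSeries n) (X : Fin n → H →L[ℂ] H) (N : ℕ) : H →L[ℂ] H :=
  ∑ k ∈ Finset.range N, homPart G X k

/-- The series `G(X) = ∑_k ∑_{|α| = k} a_α X_α` converges in operator norm, with sum `A`. -/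
def HasNormEval (G : NCSeries n) (X : Fin n → H →L[ℂ] H) (A : H →L[ℂ] H) : Prop :=
  Tendsto (partialSum G X) atTop (𝓝 A)

/-- The series `G(X) = ∑_k ∑_{|α| = k} a_α X_α` converges in the strong operator topology, with
sum `A`. -/
def HasSOTEval (G : NCSeries n) (X : Fin n → H →L[ℂ] H) (A : H →L[ℂ] H) : Prop :=
  ∀ x : H, Tendsto (fun N => partialSum G X N x) atTop (𝓝 (A x))

/-- For some `δ ∈ (0, 1)`, the series `G(rX)` converges in norm for all `r ∈ (δ, 1)`, and
`A = SOT-lim_{r → 1} G(rX)`. -/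
def HasRadialEval (G : NCSeries n) (X : Fin n → H →L[ℂ] H) (A : H →L[ℂ] H) : Prop :=
  ∃ B : ℝ → (H →L[ℂ] H),
    (∃ δ ∈ Set.Ioo (0 : ℝ) 1, ∀ r ∈ Set.Ioo δ 1,
      HasNormEval G (fun i => (r : ℂ) • X i) (B r)) ∧
    ∀ x : H, Tendsto (fun r => B r x) (𝓝[<] (1 : ℝ)) (𝓝 (A x))

/-- The tuple `X` lies in the set of SOT convergence, or in the set of radial convergence, of the
tuple of series `f`, and `Y` is the value `f(X)` obtained there. -/
def HasTupleEval (f : Fin n → NCSeries n) (X Y : Fin n → H →L[ℂ] H) : Prop :=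
  (∀ j, HasSOTEval (f j) X (Y j)) ∨ (∀ j, HasRadialEval (f j) X (Y j))

variable [CompleteSpace H]

/-- The norm `‖X‖ = ‖X₁ X₁^* + ⋯ + Xₙ Xₙ^*‖^{1/2}` of the row `[X₁, …, Xₙ]`. -/
def rowNorm (X : Fin n → H →L[ℂ] H) : ℝ :=
  Real.sqrt ‖∑ i, X i * ContinuousLinearMap.adjoint (X i)‖

/-- `SOT-lim_k ∑_{|α| = k} Y_α Y_α^* = 0`. -/
def IsPureRow (Y : Fin n → H →L[ℂ] H) : Prop :=
  ∀ x : H, Tendsto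
    (fun k : ℕ => (∑ w : Fin k → Fin n,
      opWord Y (List.ofFn w) * ContinuousLinearMap.adjoint (opWord Y (List.ofFn w))) x)
    atTop (𝓝 0)

end Evaluation

/-- The separable infinite dimensional Hilbert space on which free holomorphic functions are
represented. -/
abbrev SepHilbert : Type := lp (fun _ : ℕ => ℂ) 2

/-- The open operatorial ball `[B(𝓗)ⁿ]_γ`, with `𝓗` separable and infinite dimensional. -/
def opBall (n : ℕ) (γ : ℝ) : Set (Fin n → SepHilbert →L[ℂ] SepHilbert) :=
  {X | rowNorm X < γ}

/-! ### The spaces `H²(f)` and the multiplication operators -/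

/-- The three kinds of tuples `f`: tuples of polynomials, tuples of formal power series vanishing
at zero, and tuples of free holomorphic functions on the ball of radius `γ`. -/
inductive ModelClass : Type
  | polynomial : ModelClass
  | powerSeries : ModelClass
  | freeHolomorphic (γ : ℝ) : ModelClass

/-- The Hilbert space `H²(f)` with orthonormal basis `{f_α}`, i.e. the completion of the span of
the `f_α` for the inner product `⟨f_α, f_β⟩ = δ_{αβ}`. The square summable family `a` stands for the
element `∑_α a_α f_α`. That element is the polynomial `comp a f` for polynomials `f` and
finitely supported `a`, the formal power series `comp a f` when `f(0) = 0`, and the function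
`X ↦ ∑_α a_α [f(X)]_α` in the free holomorphic case; `IsLeftMul` refers to these realizations. -/
abbrev HardySpace {n : ℕ} (_f : Fin n → NCSeries n) : Type := lp (fun _ : Word n => ℂ) 2

/-- The basis vector `f_α` of `H²(f)`. -/
def basisVec {n : ℕ} (f : Fin n → NCSeries n) (α : Word n) : HardySpace f :=
  lp.single 2 α (1 : ℂ)

/-- `A` is the operator of left multiplication by `ψ` on `H²(f)`: `A x = ψ x`. In the polynomial
case the equation is required for all polynomials `x`, a dense subspace of `H²(f)`. In the free
holomorphic case it is an equation between functions of `X` in the ball of radius `γ`. -/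
def IsLeftMul {n : ℕ} : ModelClass → (f : Fin n → NCSeries n) → NCSeries n →
    (HardySpace f →L[ℂ] HardySpace f) → Prop
  | .polynomial, f, ψ, A => ∀ a : HardySpace f, IsPolynomial (a : NCSeries n) →
      IsPolynomial (A a : NCSeries n) ∧ comp (A a) f = mulSeries ψ (comp a f)
  | .powerSeries, f, ψ, A => ∀ a : HardySpace f, comp (A a) f = mulSeries ψ (comp a f)
  | .freeHolomorphic γ, f, ψ, A => ∀ a : HardySpace f, ∀ X ∈ opBall n γ,
      ∀ (Y : Fin n → SepHilbert →L[ℂ] SepHilbert) (P : SepHilbert →L[ℂ] SepHilbert),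
        (∀ j, HasNormEval (f j) X (Y j)) → HasNormEval ψ X P →
        ∃ B, HasNormEval (a : NCSeries n) Y B ∧ HasNormEval (A a : NCSeries n) Y (P * B)

/-- The operator `M_{Z_i}` of left multiplication by `Z_i` on `H²(f)`: the bounded operator
singled out by `IsLeftMul`. -/
def mulZ {n : ℕ} (c : ModelClass) (f : Fin n → NCSeries n) (i : Fin n) :
    HardySpace f →L[ℂ] HardySpace f :=
  Classical.epsilon (IsLeftMul c f (Z i))

/-- `M_{f_j} = f_j(M_{Z_1}, …, M_{Z_n})` for all `j`, where `(M_{Z_1}, …, M_{Z_n})` is in the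
set of SOT convergence or in the set of radial convergence of `f`. -/
def MulIsEval {n : ℕ} (c : ModelClass) (f : Fin n → NCSeries n) : Prop :=
  ∃ A : Fin n → HardySpace f →L[ℂ] HardySpace f,
    HasTupleEval f (mulZ c f) A ∧ ∀ j, IsLeftMul c f (f j) (A j)

/-! ### The model property -/

/-- Property `(𝒜)`: `f` is a tuple of polynomials which is invertible, with respect to
composition, among tuples of polynomials. -/
def PropertyA {n : ℕ} (f : Fin n → NCSeries n) : Prop :=
  (∀ i, IsPolynomial (f i)) ∧
  ∃ q : Fin n → NCSeries n, (∀ i, IsPolynomial (q i)) ∧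
    (∀ i, comp (f i) q = Z i) ∧ ∀ i, comp (q i) f = Z i

/-- Property `(𝒮)` for tuples of formal power series with `f(0) = 0`. -/
structure PropertyS {n : ℕ} (f : Fin n → NCSeries n) : Prop where
  zero : ∀ i, f i [] = 0
  radius : ∀ i, invRadius (f i) ≠ ⊤
  jacobian : (jacobianZero f).det ≠ 0
  mem : ∀ i, ∃ a : HardySpace f, comp a f = Z i
  multiplier : ∀ i, ∃ M : HardySpace f →L[ℂ] HardySpace f, IsLeftMul .powerSeries f (Z i) M
  mul_eq_eval : MulIsEval .powerSeries f

/-- Property `(𝓕)` for tuples of free holomorphic functions on the ball of radius `γ`. -/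
structure PropertyF {n : ℕ} (γ : ℝ) (f : Fin n → NCSeries n) : Prop where
  pos : 0 < γ
  holomorphic : ∀ i, invRadius (f i) ≤ ENNReal.ofReal (1 / γ)
  range : ∀ X ∈ opBall n γ, ∃ Y ∈ opBall n 1, ∀ j, HasNormEval (f j) X (Y j)
  not_right_zero_divisor : ∀ G : NCSeries n, invRadius G ≤ 1 →
    (∀ X ∈ opBall n γ, ∀ Y, (∀ j, HasNormEval (f j) X (Y j)) → HasNormEval G Y 0) → G = 0
  mem : ∀ i, ∃ a : HardySpace f, ∀ X ∈ opBall n γ, ∀ Y,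
    (∀ j, HasNormEval (f j) X (Y j)) → HasNormEval (a : NCSeries n) Y (X i)
  multiplier : ∀ i, ∃ M : HardySpace f →L[ℂ] HardySpace f,
    IsLeftMul (.freeHolomorphic γ) f (Z i) M
  mul_eq_eval : MulIsEval (.freeHolomorphic γ) f

/-- `f` has the model property, as a member of the class `c`. -/
def HasModelProperty {n : ℕ} : ModelClass → (Fin n → NCSeries n) → Prop
  | .polynomial, f => PropertyA f
  | .powerSeries, f => PropertyS f
  | .freeHolomorphic γ, f => PropertyF γ f

/-- `g ∘ f = id`: as polynomials, as formal power series, or as free holomorphic functions, with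
`g` free holomorphic on the unit ball and `g(f(X)) = X` on the ball of radius `γ`. -/
def IsCompInverse {n : ℕ} : ModelClass → (Fin n → NCSeries n) → (Fin n → NCSeries n) → Prop
  | .polynomial, f, g => (∀ i, IsPolynomial (g i)) ∧ ∀ i, comp (g i) f = Z i
  | .powerSeries, f, g => ∀ i, comp (g i) f = Z i
  | .freeHolomorphic γ, f, g => (∀ i, invRadius (g i) ≤ 1) ∧
      ∀ X ∈ opBall n γ, ∀ Y, (∀ j, HasNormEval (f j) X (Y j)) → ∀ i, HasNormEval (g i) Y (X i)

/-- The inverse `g` of `f` with respect to composition. -/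
def compInverse {n : ℕ} (c : ModelClass) (f : Fin n → NCSeries n) : Fin n → NCSeries n :=
  Classical.epsilon (IsCompInverse c f)

/-! ### The noncommutative domain and the universal model -/

section Domain

variable {n : ℕ} {H : Type*} [NormedAddCommGroup H] [InnerProductSpace ℂ H] [CompleteSpace H]

/-- `X` belongs to the domain `𝔹_f(H) = {X : g(f(X)) = X and ‖f(X)‖ ≤ 1}`, and `Y = f(X)`. -/
structure IsDomainElement (c : ModelClass) (f : Fin n → NCSeries n)
    (X Y : Fin n → H →L[ℂ] H) : Prop where
  eval : HasTupleEval f X Y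
  inverse : HasTupleEval (compInverse c f) Y X
  contractive : rowNorm Y ≤ 1

/-- `X` is a pure element of `𝔹_f(H)`. -/
def IsPureElement (c : ModelClass) (f : Fin n → NCSeries n) (X : Fin n → H →L[ℂ] H) : Prop :=
  ∃ Y : Fin n → H →L[ℂ] H, IsDomainElement c f X Y ∧ IsPureRow Y

/-- Compression `P_K A|_K` of an operator to a closed subspace. -/
def compression (K : ClosedSubmodule ℂ H) (A : H →L[ℂ] H) :
    K.toSubmodule →L[ℂ] K.toSubmodule :=
  K.toSubmodule.orthogonalProjectionOnto ∘L A ∘L K.toSubmodule.subtypeL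

/-- `K` is co-invariant under each `A i`, i.e. invariant under each adjoint. -/
def IsCoinvariant (K : ClosedSubmodule ℂ H) (A : Fin n → H →L[ℂ] H) : Prop :=
  ∀ i, ∀ x ∈ K, ContinuousLinearMap.adjoint (A i) x ∈ K

end Domain

/-- Unitary equivalence of tuples: `A_i = U^* B_i U` for a unitary `U`. -/
def UnitarilyEquivalent {n : ℕ} {H K : Type*} [NormedAddCommGroup H] [InnerProductSpace ℂ H]
    [NormedAddCommGroup K] [InnerProductSpace ℂ K]
    (A : Fin n → H →L[ℂ] H) (B : Fin n → K →L[ℂ] K) : Prop :=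
  ∃ U : H ≃ₗᵢ[ℂ] K, ∀ i x, A i x = U.symm (B i (U x))

/-- The Hilbert space tensor product `E ⊗ D`. -/
abbrev HilbertTensor (E D : Type*) [NormedAddCommGroup E] [InnerProductSpace ℂ E]
    [NormedAddCommGroup D] [InnerProductSpace ℂ D] : Type _ :=
  UniformSpace.Completion (E ⊗[ℂ] D)

/-- The operator `A ⊗ I_D` on the Hilbert space tensor product. -/
def ampliation {E : Type*} [NormedAddCommGroup E] [InnerProductSpace ℂ E]
    (D : Type*) [NormedAddCommGroup D] [InnerProductSpace ℂ D] (A : E →L[ℂ] E) :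
    HilbertTensor E D →L[ℂ] HilbertTensor E D :=
  (A.rTensor D).completion

/-! ### The noncommutative Poisson kernel -/

section Poisson

variable {n : ℕ} {H : Type*} [NormedAddCommGroup H] [InnerProductSpace ℂ H] [CompleteSpace H]

/-- The defect operator `Δ = (I - ∑_j Y_j Y_j^*)^{1/2}`. -/
def defectOp (Y : Fin n → H →L[ℂ] H) : H →L[ℂ] H :=
  CFC.sqrt (1 - ∑ j, Y j * ContinuousLinearMap.adjoint (Y j))

/-- The defect space, the closure of the range of `Δ`. -/
def defectSpace (Y : Fin n → H →L[ℂ] H) : Submodule ℂ H :=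
  (LinearMap.range (defectOp Y).toLinearMap).topologicalClosure

/-- `Δ` as a map into the defect space. -/
def defectMap (Y : Fin n → H →L[ℂ] H) (h : H) : defectSpace Y :=
  ⟨defectOp Y h, Submodule.le_topologicalClosure _ ⟨h, rfl⟩⟩

/-- `K` is the noncommutative Poisson kernel `K h = ∑_α f_α ⊗ Δ Y_α^* h`, where `Y = f(T)`. -/
def IsPoissonKernel (f : Fin n → NCSeries n) (Y : Fin n → H →L[ℂ] H)
    (K : H → HilbertTensor (HardySpace f) (defectSpace Y)) : Prop :=
  ∀ h : H, HasSum
    (fun α : Word n => ((basisVec f α ⊗ₜ[ℂ]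
        defectMap Y (ContinuousLinearMap.adjoint (opWord Y α) h) :
        HardySpace f ⊗[ℂ] defectSpace Y) : HilbertTensor (HardySpace f) (defectSpace Y)))
    (K h)

end Poisson

end NCModel

end

noncomputable section

namespace NCModel

/-! ### Words and homogeneous sums -/

section Words

variable {n : ℕ}

/-! Everything takes place on the sequence space `L2 n`: sending `f_α` to the basis vector `e_α`
turns `M_{f_j}` into the left creation operator `S_j = lshift j`, and right multiplication by `f_j`
into the right creation operator. Left and right multiplications commute, so `M_{Z_i}` commutes with
all right creation operators, and `M_{Z_i} e_∅` has the coefficients of `g_i`, because `Z_i = g_i ∘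
f`. Thus `M_{Z_i}` is a multiplier with symbol `g_i` (`IsMultiplier`), and `f(M_Z) = S`. These two
facts are all that is needed of the model property. In each of the three cases they come from
injectivity of `G ↦ G ∘ f`.

From a pure `T` to the model: `Y = f(T)` is a pure row contraction. Its Poisson kernel `K` is an
isometry, by a telescoping sum, and `Y_i K^* = K^* (S_i ⊗ I)`. Applying the series `g_i` to both
sides gives `T_i K^* = K^* (M_{Z_i} ⊗ I)` (`poissonKernel_intertwines`), so the range of `K` is the
required co-invariant subspace.

From the model to `T`: if `V` embeds `H` onto a co-invariant subspace, then `T_i V^* = V^* (M_{Z_i}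
⊗ I)`. Evaluations of series pass through such relations. Compressing `f(M_Z) = S` gives `f(T) = Y`
with `Y_j = V^* (S_j ⊗ I) V`, and compressing `g(S) = M_Z` gives `g(Y) = T`; contractivity and
purity are inherited from `S`.

The analytic point is that `g(S) = M_Z` holds radially (`IsMultiplier.hasRadialEval`). Partial sums
of a multiplier need not be bounded, but its dilates are: `rS` is itself a pure row contraction, and
its Poisson kernel gives `‖g_i(rS)‖ ≤ ‖M_{Z_i}‖`. -/

theorem sum_ofFn_cons {M : Type*} [AddCommMonoid M] (F : Word n → M) (k : ℕ) :
    ∑ w : Fin (k + 1) → Fin n, F (List.ofFn w) =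
      ∑ i, ∑ w : Fin k → Fin n, F (i :: List.ofFn w) := by
  rw [← (Fin.consEquiv (fun _ => Fin n)).sum_comp, Fintype.sum_prod_type]
  simp [Fin.consEquiv, List.ofFn_succ]

theorem sum_ofFn_snoc {M : Type*} [AddCommMonoid M] (F : Word n → M) (k : ℕ) :
    ∑ w : Fin (k + 1) → Fin n, F (List.ofFn w) =
      ∑ i, ∑ w : Fin k → Fin n, F (List.ofFn w ++ [i]) := by
  rw [← (Fin.snocEquiv (fun _ => Fin n)).sum_comp, Fintype.sum_prod_type]
  simp only [Fin.snocEquiv, Equiv.coe_fn_mk, List.ofFn_succ', Fin.snoc_castSucc, Fin.snoc_last,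
    List.concat_eq_append]

variable {H : Type*} [NormedAddCommGroup H] [InnerProductSpace ℂ H]
  {E : Type*} [NormedAddCommGroup E] [InnerProductSpace ℂ E]

@[simp] theorem opWord_nil (X : Fin n → H →L[ℂ] H) : opWord X [] = 1 := rfl

@[simp] theorem opWord_cons (X : Fin n → H →L[ℂ] H) (i : Fin n) (α : Word n) :
    opWord X (i :: α) = X i * opWord X α := by simp [opWord]

theorem opWord_append (X : Fin n → H →L[ℂ] H) (α β : Word n) :
    opWord X (α ++ β) = opWord X α * opWord X β := by simp [opWord]

theorem opWord_smul (r : ℂ) (X : Fin n → H →L[ℂ] H) (α : Word n) :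
    opWord (fun i => r • X i) α = r ^ α.length • opWord X α := by
  induction α with
  | nil => simp
  | cons i α ih =>
    rw [opWord_cons, opWord_cons, ih, smul_mul_smul_comm, List.length_cons, pow_succ']

theorem homPart_smul (G : NCSeries n) (r : ℂ) (X : Fin n → H →L[ℂ] H) (k : ℕ) :
    homPart G (fun i => r • X i) k = r ^ k • homPart G X k := by
  simp only [homPart, opWord_smul, List.length_ofFn, Finset.smul_sum]
  exact Finset.sum_congr rfl fun w _ => smul_comm _ _ _

theorem partialSum_sub (F G : NCSeries n) (X : Fin n → H →L[ℂ] H) (N : ℕ) :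
    partialSum (F - G) X N = partialSum F X N - partialSum G X N := by
  simp [partialSum, homPart, sub_smul, Finset.sum_sub_distrib]

/-- Intertwining passes from tuples to words. -/
theorem opWord_comp_of_intertwines {T : Fin n → H →L[ℂ] H} {A : Fin n → E →L[ℂ] E}
    {C : E →L[ℂ] H} (h : ∀ i, T i ∘L C = C ∘L A i) (α : Word n) :
    opWord T α ∘L C = C ∘L opWord A α := by
  induction α with
  | nil => ext x; simp
  | cons i α ih =>
    ext x
    have h1 := DFunLike.congr_fun ih x
    have h2 := DFunLike.congr_fun (h i) (opWord A α x)
    simp only [ContinuousLinearMap.comp_apply, opWord_cons, mul_apply_eq_comp] at *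
    rw [h1, h2]

theorem partialSum_comp_of_intertwines {T : Fin n → H →L[ℂ] H} {A : Fin n → E →L[ℂ] E}
    {C : E →L[ℂ] H} (h : ∀ i, T i ∘L C = C ∘L A i) (G : NCSeries n) (N : ℕ) :
    partialSum G T N ∘L C = C ∘L partialSum G A N := by
  ext x
  have := fun α => DFunLike.congr_fun (opWord_comp_of_intertwines h α) x
  simp only [ContinuousLinearMap.comp_apply] at this
  simp [partialSum, homPart, map_sum, this]

theorem intertwines_smul {T : Fin n → H →L[ℂ] H} {A : Fin n → E →L[ℂ] E}
    {C : E →L[ℂ] H} (h : ∀ i, T i ∘L C = C ∘L A i) (r : ℂ) (i : Fin n) :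
    (r • T i) ∘L C = C ∘L (r • A i) := by
  rw [ContinuousLinearMap.smul_comp, h, ContinuousLinearMap.comp_smul]

end Words

/-! ### Strong limits -/

section StrongLimits

variable {ι E F : Type*} [NormedAddCommGroup E] [NormedSpace ℂ E]
  [NormedAddCommGroup F] [NormedSpace ℂ F]

/-- A bounded family of operators which converges strongly on a total set converges strongly. -/
theorem tendsto_of_total {l : Filter ι} {A : ι → E →L[ℂ] F} {B : E →L[ℂ] F} {C : ℝ}
    (hA : ∀ᶠ i in l, ‖A i‖ ≤ C) {s : Set E} (hs : Dense (Submodule.span ℂ s : Set E))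
    (h : ∀ x ∈ s, Tendsto (fun i => A i x) l (𝓝 (B x))) (x : E) :
    Tendsto (fun i => A i x) l (𝓝 (B x)) := by
  have hspan : ∀ y ∈ Submodule.span ℂ s, Tendsto (fun i => A i y) l (𝓝 (B y)) := by
    intro y hy
    induction hy using Submodule.span_induction with
    | mem y hy => exact h y hy
    | zero => simpa using tendsto_const_nhds
    | add y z _ _ hy hz => simpa using hy.add hz
    | smul c y _ hy => simpa using hy.const_smul c
  rw [Metric.tendsto_nhds]
  intro ε hε
  -- `D` bounds the operators and the limit together; `max` and `+ 1` keep it positive, even when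
  -- `C` is negative.
  set D := max C 0 + ‖B‖ + 1 with hD
  have hDpos : 0 < D := by positivity
  obtain ⟨y, hy, hxy⟩ := Metric.mem_closure_iff.1 (hs x) (ε / (2 * D)) (by positivity)
  filter_upwards [hA, Metric.tendsto_nhds.1 (hspan y hy) (ε / 2) (by positivity)] with i hi hi'
  have e1 : A i x - B x = A i (x - y) + (A i y - B y) - B (x - y) := by
    simp only [map_sub]; abel
  rw [dist_eq_norm] at hxy hi' ⊢
  have h1 : ‖A i (x - y)‖ ≤ max C 0 * ‖x - y‖ :=
    (A i).le_of_opNorm_le (hi.trans (le_max_left _ _)) _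
  have h2 : ‖B (x - y)‖ ≤ ‖B‖ * ‖x - y‖ := B.le_opNorm _
  have h3 : D * ‖x - y‖ < ε / 2 := by
    calc D * ‖x - y‖ < D * (ε / (2 * D)) := by gcongr
      _ = ε / 2 := by field_simp
  rw [e1]
  have h4 := norm_sub_le (A i (x - y) + (A i y - B y)) (B (x - y))
  have h5 := norm_add_le (A i (x - y)) (A i y - B y)
  have h6 := norm_nonneg (x - y)
  nlinarith

theorem exists_norm_le_of_tendsto [CompleteSpace E] {A : ℕ → E →L[ℂ] F} {B : E → F}
    (h : ∀ x, Tendsto (fun i => A i x) atTop (𝓝 (B x))) : ∃ C, ∀ i, ‖A i‖ ≤ C := by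
  refine banach_steinhaus fun x => ?_
  obtain ⟨C, hC⟩ := (h x).norm.bddAbove_range
  exact ⟨C, fun i => hC ⟨i, rfl⟩⟩

theorem eq_of_total [T2Space F] {A B : E →L[ℂ] F} {s : Set E}
    (hs : Dense (Submodule.span ℂ s : Set E)) (h : ∀ x ∈ s, A x = B x) : A = B :=
  ContinuousLinearMap.ext_on hs h

end StrongLimits

/-! ### Ampliations -/

section Ampliation

variable {E D : Type*} [NormedAddCommGroup E] [InnerProductSpace ℂ E]
  [NormedAddCommGroup D] [InnerProductSpace ℂ D]

/-- The elementary tensor `x ⊗ d` in the Hilbert space tensor product. -/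
def htmul (x : E) (d : D) : HilbertTensor E D := ((x ⊗ₜ[ℂ] d : E ⊗[ℂ] D) : HilbertTensor E D)

theorem inner_htmul (x y : E) (d e : D) :
    inner ℂ (htmul x d) (htmul y e) = inner ℂ x y * inner ℂ d e := by
  simp [htmul]

/-- `x ↦ x ⊗ d` as a continuous linear map. -/
def htmulLeft (d : D) : E →L[ℂ] HilbertTensor E D :=
  UniformSpace.Completion.toComplL ∘L (TensorProduct.mkL ℂ E D).flip d

@[simp] theorem htmulLeft_apply (d : D) (x : E) : htmulLeft d x = htmul x d := rfl

/-- `d ↦ x ⊗ d` as a continuous linear map. -/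
def htmulRight (x : E) : D →L[ℂ] HilbertTensor E D :=
  UniformSpace.Completion.toComplL ∘L (TensorProduct.mkL ℂ E D) x

@[simp] theorem htmulRight_apply (d : D) (x : E) : htmulRight x d = htmul x d := rfl

theorem htmul_add_left (x y : E) (d : D) : htmul (x + y) d = htmul x d + htmul y d :=
  map_add (htmulLeft d) x y

theorem htmul_smul_left (c : ℂ) (x : E) (d : D) : htmul (c • x) d = c • htmul x d :=
  map_smul (htmulLeft d) c x

@[simp] theorem norm_htmul (x : E) (d : D) : ‖htmul x d‖ = ‖x‖ * ‖d‖ := by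
  simp [htmul]

/-- For fixed `d` the vectors `x` with `x ⊗ d` in the closed span form a closed subspace containing
`s`, hence all of `E`; elementary tensors then generate a dense subspace. -/
theorem total_htmul {s : Set E} (hs : Dense (Submodule.span ℂ s : Set E)) :
    Dense (Submodule.span ℂ {z : HilbertTensor E D | ∃ x ∈ s, ∃ d : D, z = htmul x d} :
      Set (HilbertTensor E D)) := by
  set P := (Submodule.span ℂ {z : HilbertTensor E D | ∃ x ∈ s, ∃ d : D, z = htmul x d})
  have key : ∀ z : E ⊗[ℂ] D, (z : HilbertTensor E D) ∈ P.topologicalClosure := by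
    intro z
    induction z using TensorProduct.induction_on with
    | zero => exact P.topologicalClosure.zero_mem
    | add x y hx hy =>
      rw [UniformSpace.Completion.coe_add]
      exact P.topologicalClosure.add_mem hx hy
    | tmul x d =>
      have h1 : Submodule.span ℂ s ≤
          P.topologicalClosure.comap (htmulLeft (E := E) d).toLinearMap := by
        rw [Submodule.span_le]
        intro y hy
        exact P.le_topologicalClosure (Submodule.subset_span ⟨y, hy, d, rfl⟩)
      have h2 : IsClosed (htmulLeft (E := E) d ⁻¹' (P.topologicalClosure : Set _)) :=
        P.isClosed_topologicalClosure.preimage (htmulLeft d).continuous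
      exact h2.closure_subset_iff.2 h1 (hs x)
  intro z
  rw [← Submodule.topologicalClosure_coe]
  exact P.isClosed_topologicalClosure.closure_subset_iff.2
    (Set.range_subset_iff.2 key) (UniformSpace.Completion.denseRange_coe z)

@[simp] theorem ampliation_htmul (A : E →L[ℂ] E) (x : E) (d : D) :
    ampliation D A (htmul x d) = htmul (A x) d := by
  simp [ampliation, htmul]

theorem ext_htmul {F : Type*} [NormedAddCommGroup F] [NormedSpace ℂ F]
    {A B : HilbertTensor E D →L[ℂ] F} (h : ∀ x d, A (htmul x d) = B (htmul x d)) : A = B := by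
  refine eq_of_total (total_htmul (E := E) (D := D) (s := Set.univ) ?_) ?_
  · simp
  · rintro _ ⟨x, -, d, rfl⟩; exact h x d

variable (E D) in
/-- `A ↦ A ⊗ I_D` as an algebra homomorphism. -/
def ampliationHom : (E →L[ℂ] E) →ₐ[ℂ] (HilbertTensor E D →L[ℂ] HilbertTensor E D) :=
  AlgHom.ofLinearMap
    { toFun := ampliation D
      map_add' := fun A B => ext_htmul fun x d => by simp [htmul_add_left]
      map_smul' := fun c A => ext_htmul fun x d => by simp [htmul_smul_left] }
    (ext_htmul fun x d => by simp)
    (fun A B => ext_htmul fun x d => by simp)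

@[simp] theorem ampliationHom_apply (A : E →L[ℂ] E) : ampliationHom E D A = ampliation D A := rfl

theorem norm_ampliation_le (A : E →L[ℂ] E) : ‖ampliation D A‖ ≤ ‖A‖ := by
  refine ContinuousLinearMap.opNorm_le_bound _ (norm_nonneg _) fun z => ?_
  induction z using UniformSpace.Completion.induction_on with
  | hp => exact isClosed_le (by fun_prop) (by fun_prop)
  | ih z =>
    rw [ampliation, ContinuousLinearMap.completion_apply_coe, UniformSpace.Completion.norm_coe,
      UniformSpace.Completion.norm_coe]
    exact (A.rTensor D).le_of_opNorm_le (ContinuousLinearMap.norm_rTensor_le D A) z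

theorem ampliation_opWord {n : ℕ} (X : Fin n → E →L[ℂ] E) (α : Word n) :
    ampliation D (opWord X α) = opWord (fun i => ampliation D (X i)) α := by
  rw [← ampliationHom_apply, opWord, map_list_prod, List.map_map]; rfl

theorem ampliation_partialSum {n : ℕ} (G : NCSeries n) (X : Fin n → E →L[ℂ] E) (N : ℕ) :
    ampliation D (partialSum G X N) = partialSum G (fun i => ampliation D (X i)) N := by
  simp only [← ampliationHom_apply, partialSum, homPart, map_sum, map_smul]
  simp [ampliation_opWord]

theorem ampliation_adjoint [CompleteSpace E] (A : E →L[ℂ] E) :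
    ampliation D (ContinuousLinearMap.adjoint A) =
      ContinuousLinearMap.adjoint (ampliation D A) := by
  refine ext_htmul fun x d => ?_
  refine ext_inner_right ℂ fun z => ?_
  rw [ContinuousLinearMap.adjoint_inner_left, ampliation_htmul]
  have : innerSL ℂ (htmul (ContinuousLinearMap.adjoint A x) d) =
      (innerSL ℂ (htmul x d)) ∘L ampliation D A :=
    ext_htmul fun y e => by simp [inner_htmul, ContinuousLinearMap.adjoint_inner_left]
  exact DFunLike.congr_fun this z

/-- Ampliation preserves strong convergence of sequences. -/
theorem tendsto_ampliation [CompleteSpace E] {A : ℕ → E →L[ℂ] E} {B : E →L[ℂ] E}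
    (h : ∀ x, Tendsto (fun i => A i x) atTop (𝓝 (B x))) (z : HilbertTensor E D) :
    Tendsto (fun i => ampliation D (A i) z) atTop (𝓝 (ampliation D B z)) := by
  obtain ⟨C, hC⟩ := exists_norm_le_of_tendsto h
  refine tendsto_of_total (Eventually.of_forall fun i => (norm_ampliation_le _).trans (hC i))
    (total_htmul (E := E) (D := D) (s := Set.univ) (by simp)) ?_ z
  rintro _ ⟨x, -, d, rfl⟩
  simpa [Function.comp_def] using ((htmulLeft d).continuous.tendsto _).comp (h x)

end Ampliation

/-! ### Words of bounded length -/

section WordsLT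

variable {n : ℕ}

/-- The words of length less than `N`. -/
def wordsLT (n N : ℕ) : Finset (Word n) :=
  (Finset.range N).biUnion fun k => Finset.univ.image fun w : Fin k → Fin n => List.ofFn w

@[simp] theorem mem_wordsLT {N : ℕ} {α : Word n} : α ∈ wordsLT n N ↔ α.length < N := by
  simp only [wordsLT, Finset.mem_biUnion, Finset.mem_range, Finset.mem_image, Finset.mem_univ,
    true_and]
  constructor
  · rintro ⟨k, hk, w, rfl⟩; simpa using hk
  · exact fun h => ⟨α.length, h, α.get, List.ofFn_get α⟩

theorem sum_wordsLT {M : Type*} [AddCommMonoid M] (F : Word n → M) (N : ℕ) :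
    ∑ α ∈ wordsLT n N, F α = ∑ k ∈ Finset.range N, ∑ w : Fin k → Fin n, F (List.ofFn w) := by
  rw [wordsLT, Finset.sum_biUnion]
  · refine Finset.sum_congr rfl fun k _ => ?_
    rw [Finset.sum_image fun _ _ _ _ h => List.ofFn_injective h]
  · intro k _ l _ hkl
    refine Finset.disjoint_left.2 fun α h1 h2 => hkl ?_
    simp only [Finset.mem_image, Finset.mem_univ, true_and] at h1 h2
    obtain ⟨w, rfl⟩ := h1
    obtain ⟨v, hv⟩ := h2
    simpa using (congrArg List.length hv).symm

theorem tendsto_wordsLT : Tendsto (wordsLT n) atTop atTop := by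
  refine tendsto_atTop_finset_of_monotone (fun N M h α hα => ?_)
    fun α => ⟨α.length + 1, by simp⟩
  rw [mem_wordsLT] at *
  omega

theorem partialSum_eq_sum_wordsLT {H : Type*} [NormedAddCommGroup H] [InnerProductSpace ℂ H]
    (G : NCSeries n) (X : Fin n → H →L[ℂ] H) (N : ℕ) :
    partialSum G X N = ∑ α ∈ wordsLT n N, G α • opWord X α :=
  (sum_wordsLT (fun α => G α • opWord X α) N).symm

/-- A nonnegative family on words is summable once its sums over lengths converge. -/
theorem hasSum_words_of_tendsto {F : Word n → ℝ} (hF : ∀ α, 0 ≤ F α) {c : ℝ}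
    (h : Tendsto (fun N => ∑ k ∈ Finset.range N, ∑ w : Fin k → Fin n, F (List.ofFn w))
      atTop (𝓝 c)) : HasSum F c := by
  simp only [← sum_wordsLT] at h
  have hmono : Monotone fun N => ∑ α ∈ wordsLT n N, F α := fun N M hNM =>
    Finset.sum_le_sum_of_subset_of_nonneg
      (fun α hα => by rw [mem_wordsLT] at *; omega) fun α _ _ => hF α
  have hs : Summable F := by
    refine summable_of_sum_le (c := c) hF fun u => ?_
    obtain ⟨N, hN⟩ := (tendsto_wordsLT (n := n)).eventually (eventually_ge_atTop u) |>.exists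
    exact (Finset.sum_le_sum_of_subset_of_nonneg hN fun α _ _ => hF α).trans
      (hmono.ge_of_tendsto h N)
  have := tendsto_nhds_unique (hs.hasSum.comp tendsto_wordsLT) h
  exact this ▸ hs.hasSum

end WordsLT

/-! ### The sequence space and its shifts -/

section Shifts

variable {n : ℕ}

/-- The space of square summable families indexed by words. -/
abbrev L2 (n : ℕ) : Type := lp (fun _ : Word n => ℂ) 2

/-- The standard orthonormal basis. -/
def ebasis (α : Word n) : L2 n := lp.single 2 α (1 : ℂ)

theorem ebasis_apply (α β : Word n) : (ebasis α : L2 n) β = if β = α then 1 else 0 := by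
  rw [ebasis, lp.single_apply]
  by_cases h : β = α
  · subst h; simp
  · simp [h]

@[simp] theorem inner_ebasis (α : Word n) (x : L2 n) : inner ℂ (ebasis α) x = x α := by
  rw [ebasis, lp.inner_single_left]; simp

theorem orthonormal_ebasis : Orthonormal ℂ (ebasis : Word n → L2 n) := by
  rw [orthonormal_iff_ite]
  intro α β
  rw [inner_ebasis, ebasis_apply]

@[simp] theorem norm_ebasis (α : Word n) : ‖(ebasis α : L2 n)‖ = 1 := orthonormal_ebasis.1 α

theorem hasSum_ebasis (x : L2 n) : HasSum (fun α => x α • ebasis α) x := by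
  have := lp.hasSum_single (E := fun _ : Word n => ℂ) (p := 2) (by simp) x
  refine this.congr_fun fun α => ?_ 
  rw [ebasis, ← lp.single_smul]; simp

theorem total_ebasis : Dense (Submodule.span ℂ (Set.range (ebasis : Word n → L2 n)) :
    Set (L2 n)) := by
  intro x
  refine mem_closure_of_tendsto (hasSum_ebasis x) (Eventually.of_forall fun s => ?_)
  exact Submodule.sum_mem _ fun α _ => Submodule.smul_mem _ _ (Submodule.subset_span ⟨α, rfl⟩)

theorem ext_ebasis {F : Type*} [NormedAddCommGroup F] [NormedSpace ℂ F] {A B : L2 n →L[ℂ] F}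
    (h : ∀ α, A (ebasis α) = B (ebasis α)) : A = B :=
  eq_of_total total_ebasis (by rintro _ ⟨α, rfl⟩; exact h α)

/-- The isometry `e_α ↦ e_{φ(α)}` for injective `φ`. -/
def push (φ : Word n → Word n) (hφ : Function.Injective φ) : L2 n →ₗᵢ[ℂ] L2 n :=
  (orthonormal_ebasis.comp φ hφ).orthogonalFamily.linearIsometry

variable {φ : Word n → Word n} (hφ : Function.Injective φ)

@[simp] theorem push_ebasis (α : Word n) : push φ hφ (ebasis α) = ebasis (φ α) := by
  rw [push]
  refine ((orthonormal_ebasis.comp φ hφ).orthogonalFamily.linearIsometry_apply_single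
    (1 : ℂ)).trans ?_
  simp

@[simp] theorem push_apply (x : L2 n) (α : Word n) : push φ hφ x (φ α) = x α := by
  rw [← inner_ebasis, ← push_ebasis hφ, LinearIsometry.inner_map_map, inner_ebasis]

theorem push_apply_of_notMem (x : L2 n) {β : Word n} (hβ : β ∉ Set.range φ) :
    push φ hφ x β = 0 := by
  have h := ((orthonormal_ebasis.comp φ hφ).orthogonalFamily.hasSum_linearIsometry x).mapL
    (innerSL ℂ (ebasis β))
  rw [← inner_ebasis]
  refine h.unique ?_
  convert hasSum_zero with α
  have : β ≠ φ α := fun h => hβ ⟨α, h.symm⟩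
  simp [LinearIsometry.toSpanSingleton, ebasis_apply, this]

theorem adjoint_push_apply (x : L2 n) (α : Word n) :
    ContinuousLinearMap.adjoint (push φ hφ).toContinuousLinearMap x α = x (φ α) := by
  rw [← inner_ebasis, ContinuousLinearMap.adjoint_inner_right]
  simp

/-- The left creation operator `e_α ↦ e_{iα}`. -/
def lshift (i : Fin n) : L2 n →L[ℂ] L2 n :=
  (push (fun α => i :: α) (List.cons_injective)).toContinuousLinearMap

/-- The right creation operator `e_α ↦ e_{αj}`. -/
def rshift (j : Fin n) : L2 n →L[ℂ] L2 n :=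
  (push (fun α => α ++ [j]) (List.append_left_injective [j])).toContinuousLinearMap

@[simp] theorem lshift_ebasis (i : Fin n) (α : Word n) :
    lshift i (ebasis α) = ebasis (i :: α) := by simp [lshift]

@[simp] theorem rshift_ebasis (j : Fin n) (α : Word n) :
    rshift j (ebasis α) = ebasis (α ++ [j]) := by simp [rshift]

@[simp] theorem lshift_cons (i j : Fin n) (x : L2 n) (α : Word n) :
    lshift i x (j :: α) = if i = j then x α else 0 := by
  split_ifs with h
  · subst h; exact push_apply List.cons_injective x α
  · exact push_apply_of_notMem List.cons_injective x (by simp [h])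

@[simp] theorem lshift_nil (i : Fin n) (x : L2 n) : lshift i x [] = 0 :=
  push_apply_of_notMem List.cons_injective x (by simp)

@[simp] theorem rshift_snoc (i j : Fin n) (x : L2 n) (α : Word n) :
    rshift i x (α ++ [j]) = if i = j then x α else 0 := by
  split_ifs with h
  · subst h; exact push_apply (List.append_left_injective [i]) x α
  · exact push_apply_of_notMem (List.append_left_injective [i]) x (by simp [h])

@[simp] theorem rshift_nil (i : Fin n) (x : L2 n) : rshift i x [] = 0 :=
  push_apply_of_notMem (List.append_left_injective [i]) x (by simp)

theorem lshift_comp_rshift (i j : Fin n) :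
    lshift i ∘L rshift j = rshift j ∘L lshift i :=
  ext_ebasis fun α => by simp

theorem opWord_lshift (α : Word n) : opWord lshift α =
    (push (fun β => α ++ β) (List.append_right_injective α)).toContinuousLinearMap := by
  refine ext_ebasis fun β => ?_
  induction α with
  | nil => simp
  | cons i α ih => simpa using congrArg (lshift i) ih

@[simp] theorem opWord_lshift_ebasis (α β : Word n) :
    opWord lshift α (ebasis β) = ebasis (α ++ β) := by simp [opWord_lshift]

theorem adjoint_opWord_lshift_apply (α β : Word n) (x : L2 n) :
    ContinuousLinearMap.adjoint (opWord lshift α) x β = x (α ++ β) := by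
  rw [opWord_lshift, adjoint_push_apply]

/-- Creation operators of distinct words of equal length have orthogonal ranges. -/
theorem adjoint_opWord_lshift_mul {k : ℕ} (w v : Fin k → Fin n) :
    ContinuousLinearMap.adjoint (opWord lshift (List.ofFn w)) * opWord lshift (List.ofFn v) =
      if w = v then 1 else 0 := by
  ext x β
  rw [mul_apply_eq_comp, adjoint_opWord_lshift_apply, opWord_lshift]
  split_ifs with h
  · subst h; exact push_apply (List.append_right_injective (List.ofFn w)) x β
  · refine push_apply_of_notMem (List.append_right_injective _) x ?_
    rintro ⟨γ, hγ⟩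
    exact h (List.ofFn_injective (List.append_inj_left hγ (by simp))).symm

theorem sum_norm_sq_le (x : L2 n) (k : ℕ) :
    ∑ w : Fin k → Fin n, ‖x (List.ofFn w)‖ ^ 2 ≤ ‖x‖ ^ 2 := by
  have h := lp.sum_rpow_le_norm_rpow (p := 2) (by simp) x
    (Finset.univ.image fun w : Fin k → Fin n => List.ofFn w)
  rw [Finset.sum_image fun _ _ _ _ h => List.ofFn_injective h] at h
  simpa using h

/-- Words of one length give isometries with orthogonal ranges, so the homogeneous part `A`
satisfies `A^* A = (∑ |x_w|²) · 1`. -/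
theorem norm_homPart_lshift_le (x : L2 n) (k : ℕ) : ‖homPart x lshift k‖ ≤ ‖x‖ := by
  have h : ContinuousLinearMap.adjoint (homPart x lshift k) * homPart x lshift k =
      ((∑ w : Fin k → Fin n, ‖x (List.ofFn w)‖ ^ 2 : ℝ) : ℂ) • (1 : L2 n →L[ℂ] L2 n) := by
    simp only [homPart, map_sum, Finset.sum_mul_sum, map_smulₛₗ, smul_mul_smul_comm,
      adjoint_opWord_lshift_mul, smul_ite, smul_zero, Finset.sum_ite_eq, Finset.mem_univ, if_true,
      ← Finset.sum_smul, Complex.conj_mul']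
    push_cast; rfl
  have h2 : ‖homPart x lshift k‖ * ‖homPart x lshift k‖ ≤ ‖x‖ ^ 2 := by
    rw [← CStarRing.norm_star_mul_self, ContinuousLinearMap.star_eq_adjoint, h, norm_smul]
    refine le_trans ?_ (sum_norm_sq_le x k)
    rw [Complex.norm_real, Real.norm_of_nonneg (by positivity)]
    exact mul_le_of_le_one_right (by positivity) ContinuousLinearMap.norm_id_le
  exact abs_le_of_sq_le_sq' (by nlinarith) (norm_nonneg x) |>.2

theorem partialSum_lshift_nil (x : NCSeries n) (N : ℕ) :
    partialSum x lshift N (ebasis []) = ∑ α ∈ wordsLT n N, x α • ebasis α := by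
  simp [partialSum_eq_sum_wordsLT]

/-- Dominated convergence in the sequence space. -/
theorem tendsto_of_dominated {ι : Type*} {l : Filter ι} [l.IsCountablyGenerated]
    {F : ι → L2 n} {x : L2 n} (hdom : ∀ᶠ i in l, ∀ β, ‖F i β‖ ≤ ‖x β‖)
    (h : ∀ β, Tendsto (fun i => F i β) l (𝓝 (x β))) : Tendsto F l (𝓝 x) := by
  have hn : ∀ y : L2 n, ‖y‖ ^ 2 = ∑' β, ‖y β‖ ^ 2 := fun y => by
    simpa using lp.norm_rpow_eq_tsum (p := 2) (by simp) y
  have hs : ∀ y : L2 n, Summable fun β => ‖y β‖ ^ 2 := fun y => by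
    simpa using (lp.hasSum_norm (p := 2) (by simp) y).summable
  have key : Tendsto (fun i => ∑' β, ‖(F i - x) β‖ ^ 2) l (𝓝 (∑' _ : Word n, (0 : ℝ))) := by
    -- The bound is `(2 |x_β|)²`, since both terms of the difference are at most `|x_β|`.
    refine tendsto_tsum_of_dominated_convergence (bound := fun β => 4 * ‖x β‖ ^ 2)
      ((hs x).mul_left 4) (fun β => ?_) ?_
    · have := ((h β).sub_const (x β)).norm.pow 2
      simpa using this
    · filter_upwards [hdom] with i hi β
      have h1 : ‖(F i - x) β‖ ≤ ‖F i β‖ + ‖x β‖ := by simpa using norm_sub_le (F i β) (x β)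
      have h2 := hi β
      have h3 := norm_nonneg ((F i - x) β)
      rw [Real.norm_of_nonneg (by positivity)]
      nlinarith
  rw [tendsto_iff_norm_sub_tendsto_zero]
  have h2 := (Real.continuous_sqrt.tendsto _).comp key
  simp only [← hn, tsum_zero, Real.sqrt_zero] at h2
  refine h2.congr fun i => ?_
  simp [Function.comp, Real.sqrt_sq (norm_nonneg _)]

end Shifts

/-! ### Powers of row contractions -/

section RowPower

variable {n : ℕ} {H : Type*} [NormedAddCommGroup H] [InnerProductSpace ℂ H] [CompleteSpace H]

/-- The sum `∑_{|α| = k} Y_α Y_α^*`. -/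
def rowPower (Y : Fin n → H →L[ℂ] H) (k : ℕ) : H →L[ℂ] H :=
  ∑ w : Fin k → Fin n,
    opWord Y (List.ofFn w) * ContinuousLinearMap.adjoint (opWord Y (List.ofFn w))

theorem isPureRow_iff (Y : Fin n → H →L[ℂ] H) :
    IsPureRow Y ↔ ∀ x, Tendsto (fun k => rowPower Y k x) atTop (𝓝 0) := Iff.rfl

theorem rowPower_one (Y : Fin n → H →L[ℂ] H) :
    rowPower Y 1 = ∑ i, Y i * ContinuousLinearMap.adjoint (Y i) := by
  rw [rowPower, sum_ofFn_cons
    (fun α => opWord Y α * ContinuousLinearMap.adjoint (opWord Y α))]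
  simp

theorem rowNorm_le_one_iff (Y : Fin n → H →L[ℂ] H) : rowNorm Y ≤ 1 ↔ ‖rowPower Y 1‖ ≤ 1 := by
  rw [rowNorm, Real.sqrt_le_iff, rowPower_one]; simp

theorem re_inner_rowPower (Y : Fin n → H →L[ℂ] H) (k : ℕ) (x : H) :
    RCLike.re (inner ℂ (rowPower Y k x) x) = ∑ w : Fin k → Fin n,
      ‖ContinuousLinearMap.adjoint (opWord Y (List.ofFn w)) x‖ ^ 2 := by
  simp only [rowPower, sum_apply, sum_inner, map_sum, mul_apply_eq_comp]
  refine Finset.sum_congr rfl fun w _ => ?_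
  rw [← ContinuousLinearMap.adjoint_inner_right, inner_self_eq_norm_sq]

theorem rowPower_smul (r : ℝ) (Y : Fin n → H →L[ℂ] H) (k : ℕ) :
    rowPower (fun i => (r : ℂ) • Y i) k = (r : ℂ) ^ (2 * k) • rowPower Y k := by
  simp only [rowPower, opWord_smul, List.length_ofFn, Finset.smul_sum, map_smulₛₗ,
    smul_mul_smul_comm]
  simp [two_mul, pow_add]

/-- The summands are projections onto the pairwise orthogonal ranges of the `S_w`, `|w| = k`; the
sum projects onto the span of the `e_α` with `|α| ≥ k`. -/
theorem rowPower_lshift_isStarProjection (k : ℕ) :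
    IsStarProjection (rowPower (lshift : Fin n → _) k) := by
  constructor
  · rw [IsIdempotentElem, rowPower, Finset.sum_mul_sum]
    refine Finset.sum_congr rfl fun w _ => ?_
    have : ∀ v : Fin k → Fin n,
        opWord lshift (List.ofFn w) * ContinuousLinearMap.adjoint (opWord lshift (List.ofFn w)) *
          (opWord lshift (List.ofFn v) *
            ContinuousLinearMap.adjoint (opWord lshift (List.ofFn v))) =
        if w = v then opWord lshift (List.ofFn w) *
          ContinuousLinearMap.adjoint (opWord lshift (List.ofFn w)) else 0 := by
      intro v
      rw [mul_assoc, ← mul_assoc (ContinuousLinearMap.adjoint _), adjoint_opWord_lshift_mul]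
      split_ifs with h
      · rw [h, one_mul]
      · simp
    simp [this]
  · simp [IsSelfAdjoint, rowPower, ← ContinuousLinearMap.star_eq_adjoint]

theorem norm_rowPower_lshift_le (k : ℕ) : ‖rowPower (lshift : Fin n → _) k‖ ≤ 1 :=
  (rowPower_lshift_isStarProjection k).norm_le

/-- `S_w^*` annihilates `e_α` as soon as `w` is longer than `α`; the uniform bound on the
projections extends the limit from the basis to every vector. -/
theorem isPureRow_lshift : IsPureRow (lshift : Fin n → _) := by
  rw [isPureRow_iff]
  intro x
  refine tendsto_of_total (B := 0) (C := 1) (Eventually.of_forall norm_rowPower_lshift_le)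
    total_ebasis ?_ x
  rintro _ ⟨α, rfl⟩
  refine tendsto_const_nhds.congr' ?_
  filter_upwards [eventually_gt_atTop α.length] with k hk
  have : ∀ w : Fin k → Fin n,
      ContinuousLinearMap.adjoint (opWord lshift (List.ofFn w)) (ebasis α) = 0 := by
    intro w
    ext β
    rw [adjoint_opWord_lshift_apply, ebasis_apply, if_neg]
    · rfl
    · rintro h
      have := congrArg List.length h
      simp at this
      omega
  simp [rowPower, this]

theorem rowNorm_smul_lshift_le {r : ℝ} (h0 : 0 ≤ r) (h1 : r ≤ 1) :
    rowNorm (fun i : Fin n => (r : ℂ) • lshift i) ≤ 1 := by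
  rw [rowNorm_le_one_iff, rowPower_smul, norm_smul]
  refine mul_le_one₀ ?_ (norm_nonneg _) (norm_rowPower_lshift_le 1)
  simpa [abs_of_nonneg h0] using pow_le_one₀ (n := 2 * 1) h0 h1

theorem isPureRow_smul_lshift {r : ℝ} (h0 : 0 ≤ r) (h1 : r ≤ 1) :
    IsPureRow (fun i : Fin n => (r : ℂ) • lshift i) := by
  rw [isPureRow_iff]
  intro x
  refine squeeze_zero_norm (fun k => ?_)
    (tendsto_zero_iff_norm_tendsto_zero.1 ((isPureRow_iff lshift).1 isPureRow_lshift x))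
  rw [rowPower_smul, smul_apply, norm_smul]
  refine mul_le_of_le_one_left (norm_nonneg _) ?_
  simpa [abs_of_nonneg h0] using pow_le_one₀ (n := 2 * k) h0 h1

theorem rowPower_ampliation {E D : Type*} [NormedAddCommGroup E] [InnerProductSpace ℂ E]
    [CompleteSpace E] [NormedAddCommGroup D] [InnerProductSpace ℂ D]
    (Y : Fin n → E →L[ℂ] E) (k : ℕ) :
    rowPower (fun i => ampliation D (Y i)) k = ampliation D (rowPower Y k) := by
  simp only [rowPower, ← ampliation_opWord, ← ampliation_adjoint]
  simp only [← ampliationHom_apply, map_sum, map_mul]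

theorem rowNorm_ampliation_lshift_le {D : Type*} [NormedAddCommGroup D]
    [InnerProductSpace ℂ D] : rowNorm (fun i : Fin n => ampliation D (lshift i)) ≤ 1 := by
  rw [rowNorm_le_one_iff, rowPower_ampliation]
  exact (norm_ampliation_le _).trans (norm_rowPower_lshift_le 1)

theorem isPureRow_ampliation_lshift {D : Type*} [NormedAddCommGroup D]
    [InnerProductSpace ℂ D] : IsPureRow (fun i : Fin n => ampliation D (lshift i)) := by
  rw [isPureRow_iff]
  intro z
  have := tendsto_ampliation (B := 0) ((isPureRow_iff lshift).1 isPureRow_lshift) z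
  rw [← ampliationHom_apply, map_zero] at this
  simpa only [rowPower_ampliation, zero_apply] using this

end RowPower

/-! ### The noncommutative Poisson kernel -/

section PoissonKernel

variable {n : ℕ} {H : Type*} [NormedAddCommGroup H] [InnerProductSpace ℂ H] [CompleteSpace H]

theorem rowPower_one_nonneg (Y : Fin n → H →L[ℂ] H) : 0 ≤ rowPower Y 1 := by
  rw [rowPower_one]
  exact Finset.sum_nonneg fun i _ => mul_star_self_nonneg (Y i)

theorem norm_defectMap_sq {Y : Fin n → H →L[ℂ] H} (hY : rowNorm Y ≤ 1) (x : H) :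
    ‖defectMap Y x‖ ^ 2 = ‖x‖ ^ 2 - ∑ i, ‖ContinuousLinearMap.adjoint (Y i) x‖ ^ 2 := by
  -- Contractivity gives the positivity under which the square root really squares to `1 - rowPower
  -- Y 1`.
  have h0 : 0 ≤ 1 - rowPower Y 1 := sub_nonneg.2
    ((CStarAlgebra.norm_le_one_iff_of_nonneg _ (rowPower_one_nonneg Y)).1
      ((rowNorm_le_one_iff Y).1 hY))
  have hΔ : defectOp Y * defectOp Y = 1 - rowPower Y 1 := by
    rw [defectOp, ← rowPower_one]; exact CFC.sqrt_mul_sqrt_self _ h0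
  have hsa : ContinuousLinearMap.adjoint (defectOp Y) = defectOp Y :=
    (IsSelfAdjoint.of_nonneg (CFC.sqrt_nonneg _)).star_eq
  have h1 : ‖defectMap Y x‖ ^ 2 = RCLike.re (inner ℂ ((defectOp Y * defectOp Y) x) x) := by
    rw [mul_apply_eq_comp, ← ContinuousLinearMap.adjoint_inner_right, hsa, inner_self_eq_norm_sq]
    rfl
  have h2 := re_inner_rowPower Y 1 x
  rw [sum_ofFn_cons (fun α => ‖ContinuousLinearMap.adjoint (opWord Y α) x‖ ^ 2)] at h2
  rw [h1, hΔ, sub_apply, inner_sub_left, map_sub, h2,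
    one_apply_eq_self, inner_self_eq_norm_sq]
  simp

theorem inner_defectMap (Y : Fin n → H →L[ℂ] H) (x : H) (d : defectSpace Y) :
    inner ℂ (defectMap Y x) d = inner ℂ x (defectOp Y d) := by
  have hsa : ContinuousLinearMap.adjoint (defectOp Y) = defectOp Y :=
    (IsSelfAdjoint.of_nonneg (CFC.sqrt_nonneg _)).star_eq
  rw [← hsa, ContinuousLinearMap.adjoint_inner_right]
  rfl

/-- With `a k = ∑_{|α| = k} ‖Y_α^* h‖²`, the words of length `k` contribute `a k - a (k + 1)`,
because `Y_i^* Y_α^* = (Y_{αi})^*`. The sum telescopes from `a 0 = ‖h‖²`, and purity says `a k → 0`.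
-/
theorem hasSum_norm_defectMap_sq {Y : Fin n → H →L[ℂ] H} (hY : rowNorm Y ≤ 1)
    (hp : IsPureRow Y) (h : H) :
    HasSum (fun α => ‖defectMap Y (ContinuousLinearMap.adjoint (opWord Y α) h)‖ ^ 2)
      (‖h‖ ^ 2) := by
  set a : ℕ → ℝ := fun k => ∑ w : Fin k → Fin n,
    ‖ContinuousLinearMap.adjoint (opWord Y (List.ofFn w)) h‖ ^ 2 with ha
  have ha0 : a 0 = ‖h‖ ^ 2 := by simp [ha, ← ContinuousLinearMap.star_eq_adjoint]
  have hlim : Tendsto a atTop (𝓝 0) := by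
    have := (Complex.continuous_re.tendsto _).comp
      ((hp h).inner (𝕜 := ℂ) (tendsto_const_nhds (x := h)))
    simp only [inner_zero_left, Complex.zero_re] at this
    exact this.congr fun k => re_inner_rowPower Y k h
  refine hasSum_words_of_tendsto (fun α => by positivity) ?_
  have key : ∀ k, ∑ w : Fin k → Fin n, ‖defectMap Y
      (ContinuousLinearMap.adjoint (opWord Y (List.ofFn w)) h)‖ ^ 2 = a k - a (k + 1) := by
    intro k
    simp only [norm_defectMap_sq hY, Finset.sum_sub_distrib, ha]
    rw [sum_ofFn_snoc (fun α => ‖ContinuousLinearMap.adjoint (opWord Y α) h‖ ^ 2),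
      Finset.sum_comm]
    simp [opWord_append, ← ContinuousLinearMap.star_eq_adjoint]
  simp only [key, Finset.sum_range_sub', ha0]
  simpa using hlim.const_sub (‖h‖ ^ 2)

/-- The coefficient isometry `h ↦ (Δ Y_α^* h)_α`. -/
def poissonCoeff {Y : Fin n → H →L[ℂ] H} (hY : rowNorm Y ≤ 1) (hp : IsPureRow Y) :
    H →ₗᵢ[ℂ] lp (fun _ : Word n => defectSpace Y) 2 where
  toFun h := ⟨fun α => defectMap Y (ContinuousLinearMap.adjoint (opWord Y α) h), memℓp_gen (by
    simpa using (hasSum_norm_defectMap_sq hY hp h).summable)⟩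
  map_add' x y := by
    ext α
    simp [defectMap]
    rfl
  map_smul' c x := by
    ext α
    simp [defectMap]
  norm_map' h := by
    rw [← sq_eq_sq₀ (norm_nonneg _) (norm_nonneg _), ← (hasSum_norm_defectMap_sq hY hp h).tsum_eq]
    have := lp.norm_rpow_eq_tsum (p := 2) (by simp)
      (⟨_, memℓp_gen (by simpa using (hasSum_norm_defectMap_sq hY hp h).summable)⟩ :
        lp (fun _ : Word n => defectSpace Y) 2)
    simp only [ENNReal.toReal_ofNat, Real.rpow_ofNat] at this
    exact this

theorem poissonCoeff_apply {Y : Fin n → H →L[ℂ] H} (hY : rowNorm Y ≤ 1) (hp : IsPureRow Y)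
    (h : H) (α : Word n) : poissonCoeff hY hp h α =
      defectMap Y (ContinuousLinearMap.adjoint (opWord Y α) h) := rfl

/-- `d ↦ e_α ⊗ d` as an isometry. -/
def ebasisTensor (D : Type*) [NormedAddCommGroup D] [InnerProductSpace ℂ D] (α : Word n) :
    D →ₗᵢ[ℂ] HilbertTensor (L2 n) D :=
  ⟨(htmulRight (ebasis α)).toLinearMap, fun d => by simp⟩

@[simp] theorem ebasisTensor_apply {D : Type*} [NormedAddCommGroup D] [InnerProductSpace ℂ D]
    (α : Word n) (d : D) : ebasisTensor D α d = htmul (ebasis α) d := rfl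

theorem orthogonalFamily_ebasisTensor (D : Type*) [NormedAddCommGroup D]
    [InnerProductSpace ℂ D] :
    OrthogonalFamily ℂ (fun _ : Word n => D) (ebasisTensor D) := fun α β h d e => by
  simp [inner_htmul, ebasis_apply, h]

/-- The noncommutative Poisson kernel of a pure row contraction. -/
def poissonKernel {Y : Fin n → H →L[ℂ] H} (hY : rowNorm Y ≤ 1) (hp : IsPureRow Y) :
    H →ₗᵢ[ℂ] HilbertTensor (L2 n) (defectSpace Y) :=
  (orthogonalFamily_ebasisTensor (defectSpace Y)).linearIsometry.comp (poissonCoeff hY hp)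

theorem hasSum_poissonKernel {Y : Fin n → H →L[ℂ] H} (hY : rowNorm Y ≤ 1) (hp : IsPureRow Y)
    (h : H) :
    HasSum (fun α => htmul (ebasis α)
      (defectMap Y (ContinuousLinearMap.adjoint (opWord Y α) h))) (poissonKernel hY hp h) :=
  (orthogonalFamily_ebasisTensor (defectSpace Y)).hasSum_linearIsometry (poissonCoeff hY hp h)

/-- In this explicit form the intertwining with the creation operators is immediate: prefixing a
letter `i` to `α` multiplies `Y_α Δ d` by `Y_i` on the left. -/
theorem adjoint_poissonKernel_htmul {Y : Fin n → H →L[ℂ] H} (hY : rowNorm Y ≤ 1)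
    (hp : IsPureRow Y) (α : Word n) (d : defectSpace Y) :
    ContinuousLinearMap.adjoint (poissonKernel hY hp).toContinuousLinearMap
      (htmul (ebasis α) d) = opWord Y α (defectOp Y d) := by
  classical
  refine ext_inner_left ℂ fun h => ?_
  rw [ContinuousLinearMap.adjoint_inner_right, ← ebasisTensor_apply,
    ← (orthogonalFamily_ebasisTensor (defectSpace Y)).linearIsometry_apply_single]
  refine ((orthogonalFamily_ebasisTensor (defectSpace Y)).linearIsometry.inner_map_map
    (poissonCoeff hY hp h) _).trans ?_
  rw [lp.inner_single_right, poissonCoeff_apply, inner_defectMap,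
    ContinuousLinearMap.adjoint_inner_left]

theorem total_ebasis_htmul (D : Type*) [NormedAddCommGroup D] [InnerProductSpace ℂ D] :
    Dense (Submodule.span ℂ
      {z : HilbertTensor (L2 n) D | ∃ x ∈ Set.range ebasis, ∃ d : D, z = htmul x d} :
      Set (HilbertTensor (L2 n) D)) := total_htmul total_ebasis

theorem ext_ebasis_htmul {D F : Type*} [NormedAddCommGroup D] [InnerProductSpace ℂ D]
    [NormedAddCommGroup F] [NormedSpace ℂ F] {A B : HilbertTensor (L2 n) D →L[ℂ] F}
    (h : ∀ α d, A (htmul (ebasis α) d) = B (htmul (ebasis α) d)) : A = B :=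
  eq_of_total (total_ebasis_htmul D) (by rintro _ ⟨_, ⟨α, rfl⟩, d, rfl⟩; exact h α d)

theorem adjoint_poissonKernel_intertwines {Y : Fin n → H →L[ℂ] H} (hY : rowNorm Y ≤ 1)
    (hp : IsPureRow Y) (i : Fin n) :
    Y i ∘L ContinuousLinearMap.adjoint (poissonKernel hY hp).toContinuousLinearMap =
      ContinuousLinearMap.adjoint (poissonKernel hY hp).toContinuousLinearMap ∘L
        ampliation (defectSpace Y) (lshift i) :=
  ext_ebasis_htmul fun α d => by simp [adjoint_poissonKernel_htmul]

end PoissonKernel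

/-! ### Evaluations of multipliers at the shifts -/

section Multipliers

variable {n : ℕ}

/-- `W` is the multiplier on the sequence space with symbol `G`: it commutes with the right creation
operators and `W e_∅ = G`. -/
structure IsMultiplier (G : NCSeries n) (W : L2 n →L[ℂ] L2 n) : Prop where
  apply_nil : ∀ β, W (ebasis []) β = G β
  comm : ∀ j, W ∘L rshift j = rshift j ∘L W

theorem IsMultiplier.symbol_eq {G : NCSeries n} {W : L2 n →L[ℂ] L2 n} (h : IsMultiplier G W) :
    G = (W (ebasis []) : NCSeries n) := funext fun β => (h.apply_nil β).symm

/-- Since `e_{αj}` is the image of `e_α` under a right creation operator, convergence at `e_∅`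
spreads to every basis vector. -/
theorem tendsto_ebasis_of_comm {ι : Type*} {l : Filter ι} {A : ι → L2 n →L[ℂ] L2 n}
    {W : L2 n →L[ℂ] L2 n} (hA : ∀ᶠ t in l, ∀ j, A t ∘L rshift j = rshift j ∘L A t)
    (hW : ∀ j, W ∘L rshift j = rshift j ∘L W)
    (h : Tendsto (fun t => A t (ebasis [])) l (𝓝 (W (ebasis [])))) (α : Word n) :
    Tendsto (fun t => A t (ebasis α)) l (𝓝 (W (ebasis α))) := by
  induction α using List.reverseRecOn with
  | nil => exact h
  | append_singleton α j ih =>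
    have h2 := (DFunLike.congr_fun (hW j) (ebasis α))
    simp only [ContinuousLinearMap.comp_apply, rshift_ebasis] at h2
    rw [h2]
    refine (((rshift j).continuous.tendsto _).comp ih).congr' ?_
    filter_upwards [hA] with t ht
    simpa using (DFunLike.congr_fun (ht j) (ebasis α)).symm

theorem partialSum_smul_lshift_comp_rshift (G : NCSeries n) (r : ℂ) (N : ℕ) (j : Fin n) :
    partialSum G (fun i => r • lshift i) N ∘L rshift j =
      rshift j ∘L partialSum G (fun i => r • lshift i) N :=
  partialSum_comp_of_intertwines (intertwines_smul (fun i => lshift_comp_rshift i j) r) G N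

/-- At `e_∅` the partial sums truncate the basis expansion of `W e_∅`. Only basis vectors are
covered, since the partial sums need not be uniformly bounded. -/
theorem IsMultiplier.tendsto_partialSum {G : NCSeries n} {W : L2 n →L[ℂ] L2 n}
    (h : IsMultiplier G W) (α : Word n) :
    Tendsto (fun N => partialSum G lshift N (ebasis α)) atTop (𝓝 (W (ebasis α))) := by
  refine tendsto_ebasis_of_comm (Eventually.of_forall fun N j => ?_) h.comm ?_ α
  · simpa using partialSum_smul_lshift_comp_rshift G 1 N j
  · simp only [partialSum_lshift_nil]
    rw [h.symbol_eq]
    exact (hasSum_ebasis (W (ebasis []))).comp tendsto_wordsLT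

/-- The degree `k` part is dominated by `r ^ k ‖x‖`, a geometric series. -/
theorem exists_hasNormEval_smul_lshift (x : L2 n) {r : ℝ} (h0 : 0 ≤ r) (h1 : r < 1) :
    ∃ B, HasNormEval x (fun i => (r : ℂ) • lshift i) B := by
  have hs : Summable fun k => homPart x (fun i => (r : ℂ) • lshift i) k := by
    refine Summable.of_norm_bounded
      ((summable_geometric_of_lt_one h0 h1).mul_right ‖x‖) fun k => ?_
    rw [homPart_smul, norm_smul, norm_pow, Complex.norm_real, Real.norm_of_nonneg h0]
    gcongr
    exact norm_homPart_lshift_le x k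
  exact ⟨_, hs.hasSum.tendsto_sum_nat⟩

theorem HasNormEval.comp_rshift {G : NCSeries n} {r : ℂ} {B : L2 n →L[ℂ] L2 n}
    (h : HasNormEval G (fun i => r • lshift i) B) (j : Fin n) :
    B ∘L rshift j = rshift j ∘L B := by
  have h1 : Tendsto (fun N => partialSum G (fun i => r • lshift i) N * rshift j) atTop
      (𝓝 (B * rshift j)) := Tendsto.mul_const _ h
  have h2 : Tendsto (fun N => rshift j * partialSum G (fun i => r • lshift i) N) atTop
      (𝓝 (rshift j * B)) := Tendsto.const_mul _ h
  refine tendsto_nhds_unique h1 (h2.congr fun N => ?_)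
  exact (partialSum_smul_lshift_comp_rshift G r N j).symm

theorem HasNormEval.apply {H : Type*} [NormedAddCommGroup H] [InnerProductSpace ℂ H]
    {G : NCSeries n} {X : Fin n → H →L[ℂ] H} {B : H →L[ℂ] H} (h : HasNormEval G X B) (x : H) :
    Tendsto (fun N => partialSum G X N x) atTop (𝓝 (B x)) :=
  ((ContinuousLinearMap.apply ℂ H x).continuous.tendsto B).comp h

theorem HasNormEval.hasSOTEval {H : Type*} [NormedAddCommGroup H] [InnerProductSpace ℂ H]
    {G : NCSeries n} {X : Fin n → H →L[ℂ] H} {B : H →L[ℂ] H} (h : HasNormEval G X B) :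
    HasSOTEval G X B := h.apply

theorem HasNormEval.lshift_apply_nil {G : NCSeries n} {r : ℂ} {B : L2 n →L[ℂ] L2 n}
    (h : HasNormEval G (fun i => r • lshift i) B) (β : Word n) :
    B (ebasis []) β = r ^ β.length * G β := by
  have h1 := ((innerSL ℂ (ebasis β)).continuous.tendsto _).comp (h.apply (ebasis []))
  simp only [innerSL_apply_apply, inner_ebasis, Function.comp_def] at h1
  refine tendsto_nhds_unique h1 (tendsto_const_nhds.congr' ?_)
  filter_upwards [eventually_gt_atTop β.length] with N hN
  rw [← inner_ebasis, partialSum_eq_sum_wordsLT]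
  simp only [opWord_smul, sum_apply, smul_apply, inner_sum, inner_smul_right,
    opWord_lshift_ebasis, inner_ebasis, ebasis_apply, List.append_nil]
  simp [hN, mul_comm]

theorem tendsto_smul_lshift_nil (x : L2 n) {B : ℝ → L2 n →L[ℂ] L2 n} {δ : ℝ}
    (hδ : δ ∈ Set.Ioo (0 : ℝ) 1)
    (h : ∀ r ∈ Set.Ioo δ 1, HasNormEval x (fun i => (r : ℂ) • lshift i) (B r)) :
    Tendsto (fun r => B r (ebasis [])) (𝓝[<] (1 : ℝ)) (𝓝 x) := by
  have hev : ∀ᶠ r in 𝓝[<] (1 : ℝ), r ∈ Set.Ioo δ 1 := Ioo_mem_nhdsLT hδ.2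
  -- Dilation multiplies the coefficient at `β` by `r ^ |β| ≤ 1`, so `x` itself dominates.
  refine tendsto_of_dominated ?_ fun β => ?_
  · filter_upwards [hev] with r hr β
    rw [(h r hr).lshift_apply_nil, norm_mul, norm_pow, Complex.norm_real,
      Real.norm_of_nonneg (hδ.1.trans hr.1).le]
    exact mul_le_of_le_one_left (norm_nonneg _) (pow_le_one₀ (hδ.1.trans hr.1).le hr.2.le)
  · have : Tendsto (fun r : ℝ => (r : ℂ) ^ β.length * x β) (𝓝[<] (1 : ℝ)) (𝓝 (x β)) := by
      have hc : Continuous fun r : ℝ => (r : ℂ) ^ β.length * x β := by fun_prop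
      simpa using (hc.tendsto 1).mono_left nhdsWithin_le_nhds
    refine this.congr' ?_
    filter_upwards [hev] with r hr
    rw [(h r hr).lshift_apply_nil]

theorem IsMultiplier.tendsto_radial {G : NCSeries n} {W : L2 n →L[ℂ] L2 n}
    (hW : IsMultiplier G W) {B : ℝ → L2 n →L[ℂ] L2 n} {δ : ℝ} (hδ : δ ∈ Set.Ioo (0 : ℝ) 1)
    (h : ∀ r ∈ Set.Ioo δ 1, HasNormEval G (fun i => (r : ℂ) • lshift i) (B r)) (α : Word n) :
    Tendsto (fun r => B r (ebasis α)) (𝓝[<] (1 : ℝ)) (𝓝 (W (ebasis α))) := by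
  have hev : ∀ᶠ r in 𝓝[<] (1 : ℝ), r ∈ Set.Ioo δ 1 := Ioo_mem_nhdsLT hδ.2
  refine tendsto_ebasis_of_comm (hev.mono fun r hr j => (h r hr).comp_rshift j) hW.comm ?_ α
  rw [hW.symbol_eq] at h
  exact tendsto_smul_lshift_nil _ hδ h

end Multipliers

/-! ### Intertwining of evaluations -/

section Intertwining

variable {n : ℕ} {H E : Type*} [NormedAddCommGroup H] [InnerProductSpace ℂ H]
  [NormedAddCommGroup E] [InnerProductSpace ℂ E]
  {D : Type*} [NormedAddCommGroup D] [InnerProductSpace ℂ D]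

theorem HasNormEval.intertwines {G : NCSeries n} {T : Fin n → H →L[ℂ] H}
    {A : Fin n → E →L[ℂ] E} {C : E →L[ℂ] H} (h : ∀ i, T i ∘L C = C ∘L A i)
    {P : H →L[ℂ] H} {Q : E →L[ℂ] E} (hP : HasNormEval G T P) (hQ : HasNormEval G A Q) :
    P ∘L C = C ∘L Q := by
  ext x
  refine tendsto_nhds_unique (hP.apply (C x)) (((C.continuous.tendsto _).comp (hQ.apply x)).congr
    fun N => ?_)
  exact (DFunLike.congr_fun (partialSum_comp_of_intertwines h G N) x).symm

theorem continuous_ampliation :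
    Continuous (ampliation D : (E →L[ℂ] E) → HilbertTensor E D →L[ℂ] HilbertTensor E D) :=
  AddMonoidHomClass.continuous_of_bound (ampliationHom E D) 1 fun A => by
    simpa using norm_ampliation_le A

theorem ampliation_smul (c : ℂ) (A : E →L[ℂ] E) :
    ampliation D (c • A) = c • ampliation D A := map_smul (ampliationHom E D) c A

theorem HasNormEval.ampliation {G : NCSeries n} {X : Fin n → E →L[ℂ] E} {A : E →L[ℂ] E}
    (h : HasNormEval G X A) :
    HasNormEval G (fun i => NCModel.ampliation D (X i)) (NCModel.ampliation D A) :=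
  ((continuous_ampliation.tendsto A).comp h).congr fun N => ampliation_partialSum G X N

theorem HasSOTEval.ampliation [CompleteSpace E] {G : NCSeries n} {X : Fin n → E →L[ℂ] E}
    {A : E →L[ℂ] E} (h : HasSOTEval G X A) :
    HasSOTEval G (fun i => NCModel.ampliation D (X i)) (NCModel.ampliation D A) := fun z =>
  (tendsto_ampliation h z).congr fun N => by rw [ampliation_partialSum]

theorem HasRadialEval.ampliation [CompleteSpace E] {G : NCSeries n} {X : Fin n → E →L[ℂ] E}
    {A : E →L[ℂ] E} (h : HasRadialEval G X A) :
    HasRadialEval G (fun i => NCModel.ampliation D (X i)) (NCModel.ampliation D A) := by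
  obtain ⟨B, ⟨δ, hδ, hB⟩, hA⟩ := h
  refine ⟨fun r => NCModel.ampliation D (B r), ⟨δ, hδ, fun r hr => ?_⟩, fun z => ?_⟩
  · simpa only [ampliation_smul] using (hB r hr).ampliation (D := D)
  · refine tendsto_of_seq_tendsto fun u hu => ?_
    exact tendsto_ampliation (fun x => (hA x).comp hu) z

theorem HasTupleEval.ampliation [CompleteSpace E] {f : Fin n → NCSeries n}
    {X A : Fin n → E →L[ℂ] E} (h : HasTupleEval f X A) :
    HasTupleEval f (fun i => NCModel.ampliation D (X i)) (fun i => NCModel.ampliation D (A i)) :=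
  h.imp (fun h j => (h j).ampliation) fun h j => (h j).ampliation

/-- Compressing an evaluation: if `C V = 1` and `T_i C = C A_i`, then the values of a series at `A`
compress to its values at `T`. -/
theorem HasSOTEval.compress {G : NCSeries n} {T : Fin n → H →L[ℂ] H}
    {A : Fin n → E →L[ℂ] E} {C : E →L[ℂ] H} {V : H →L[ℂ] E} (hCV : C ∘L V = 1)
    (h : ∀ i, T i ∘L C = C ∘L A i) {Q : E →L[ℂ] E} (hQ : HasSOTEval G A Q) :
    HasSOTEval G T (C ∘L Q ∘L V) ∧ (C ∘L Q ∘L V) ∘L C = C ∘L Q := by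
  have h1 : ∀ N x, partialSum G T N (C x) = C (partialSum G A N x) := fun N x =>
    DFunLike.congr_fun (partialSum_comp_of_intertwines h G N) x
  have hx : ∀ x, C (V x) = x := fun x => DFunLike.congr_fun hCV x
  have h2 : ∀ x, Tendsto (fun N => partialSum G T N (C x)) atTop (𝓝 (C (Q x))) := fun x =>
    ((C.continuous.tendsto _).comp (hQ x)).congr fun N => (h1 N x).symm
  refine ⟨fun x => by simpa [hx] using h2 (V x), ?_⟩
  ext x
  exact tendsto_nhds_unique (by simpa [hx] using h2 (V (C x))) (h2 x)

theorem HasNormEval.compress {G : NCSeries n} {T : Fin n → H →L[ℂ] H}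
    -- Since `C V = 1`, each partial sum at `T` is the compression of the corresponding partial sum
    -- at `A`.
    {A : Fin n → E →L[ℂ] E} {C : E →L[ℂ] H} {V : H →L[ℂ] E} (hCV : C ∘L V = 1)
    (h : ∀ i, T i ∘L C = C ∘L A i) {Q : E →L[ℂ] E} (hQ : HasNormEval G A Q) :
    HasNormEval G T (C ∘L Q ∘L V) := by
  have hc : Continuous fun Q : E →L[ℂ] E => C ∘L Q ∘L V :=
    (continuous_id.clm_comp continuous_const).const_clm_comp _ 
  refine ((hc.tendsto Q).comp hQ).congr fun N => ?_
  rw [Function.comp, ← ContinuousLinearMap.comp_assoc, ← partialSum_comp_of_intertwines h G N,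
    ContinuousLinearMap.comp_assoc, hCV]
  rfl

theorem HasRadialEval.compress {G : NCSeries n} {T : Fin n → H →L[ℂ] H}
    {A : Fin n → E →L[ℂ] E} {C : E →L[ℂ] H} {V : H →L[ℂ] E} (hCV : C ∘L V = 1)
    (h : ∀ i, T i ∘L C = C ∘L A i) {Q : E →L[ℂ] E} (hQ : HasRadialEval G A Q) :
    HasRadialEval G T (C ∘L Q ∘L V) ∧ (C ∘L Q ∘L V) ∘L C = C ∘L Q := by
  obtain ⟨B, ⟨δ, hδ, hB⟩, hA⟩ := hQ
  have hr : ∀ r ∈ Set.Ioo δ 1, HasNormEval G (fun i => (r : ℂ) • T i) (C ∘L B r ∘L V) :=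
    fun r hr => (hB r hr).compress hCV (intertwines_smul h r)
  refine ⟨⟨fun r => C ∘L B r ∘L V, ⟨δ, hδ, hr⟩, fun x => (C.continuous.tendsto _).comp (hA (V x))⟩,
    ?_⟩
  ext x
  refine tendsto_nhds_unique ((C.continuous.tendsto _).comp (hA (V (C x))))
    (((C.continuous.tendsto _).comp (hA x)).congr' ?_)
  filter_upwards [(Ioo_mem_nhdsLT hδ.2 : Set.Ioo δ 1 ∈ 𝓝[<] (1 : ℝ))] with r hrr
  exact (DFunLike.congr_fun
    ((hr r hrr).intertwines (intertwines_smul h r) (hB r hrr)) x).symm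

theorem HasTupleEval.compress {f : Fin n → NCSeries n} {T : Fin n → H →L[ℂ] H}
    {A : Fin n → E →L[ℂ] E} {C : E →L[ℂ] H} {V : H →L[ℂ] E} (hCV : C ∘L V = 1)
    (h : ∀ i, T i ∘L C = C ∘L A i) {Q : Fin n → E →L[ℂ] E} (hQ : HasTupleEval f A Q) :
    HasTupleEval f T (fun j => C ∘L Q j ∘L V) ∧ ∀ j, (C ∘L Q j ∘L V) ∘L C = C ∘L Q j := by
  rcases hQ with hQ | hQ
  · exact ⟨.inl fun j => ((hQ j).compress hCV h).1, fun j => ((hQ j).compress hCV h).2⟩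
  · exact ⟨.inr fun j => ((hQ j).compress hCV h).1, fun j => ((hQ j).compress hCV h).2⟩

/-- Convergence of `G(S)` on basis vectors is enough: both sides are bounded operators, compared on
the total set of vectors `e_α ⊗ d`. -/
theorem IsMultiplier.intertwines_of_hasSOTEval {G : NCSeries n} {W : L2 n →L[ℂ] L2 n}
    (hW : IsMultiplier G W) {Y : Fin n → H →L[ℂ] H} {C : HilbertTensor (L2 n) D →L[ℂ] H}
    (hC : ∀ i, Y i ∘L C = C ∘L NCModel.ampliation D (lshift i)) {T : H →L[ℂ] H}
    (hT : HasSOTEval G Y T) : T ∘L C = C ∘L NCModel.ampliation D W := by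
  refine ext_ebasis_htmul fun α d => ?_
  have h1 := ((C ∘L htmulLeft d).continuous.tendsto _).comp (hW.tendsto_partialSum α)
  refine tendsto_nhds_unique (hT _) ((by simpa [Function.comp_def] using h1 : Tendsto _ _ _).congr
    fun N => ?_)
  have := DFunLike.congr_fun (partialSum_comp_of_intertwines hC G N) (htmul (ebasis α) d)
  simpa [← ampliation_partialSum] using this.symm

theorem IsMultiplier.intertwines_of_hasRadialEval {G : NCSeries n} {W : L2 n →L[ℂ] L2 n}
    (hW : IsMultiplier G W) {Y : Fin n → H →L[ℂ] H} {C : HilbertTensor (L2 n) D →L[ℂ] H}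
    (hC : ∀ i, Y i ∘L C = C ∘L NCModel.ampliation D (lshift i)) {T : H →L[ℂ] H}
    (hT : HasRadialEval G Y T) : T ∘L C = C ∘L NCModel.ampliation D W := by
  obtain ⟨P, ⟨δ, hδ, hP⟩, hT⟩ := hT
  -- The symbol is the square summable vector `W e_∅`, so its dilates converge in norm for every `r
  -- < 1`, in particular for the range of `r` supplied by `hT`.
  have hex : ∀ r : ℝ, ∃ B, r ∈ Set.Ioo δ 1 → HasNormEval G (fun i => (r : ℂ) • lshift i) B := by
    intro r
    by_cases hr : r ∈ Set.Ioo δ 1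
    · obtain ⟨B, hB⟩ := exists_hasNormEval_smul_lshift (W (ebasis [])) (hδ.1.trans hr.1).le hr.2
      exact ⟨B, fun _ => by rwa [hW.symbol_eq]⟩
    · exact ⟨0, fun h => absurd h hr⟩
  choose B hB using hex
  refine ext_ebasis_htmul fun α d => ?_
  have h1 := ((C ∘L htmulLeft d).continuous.tendsto _).comp (hW.tendsto_radial hδ hB α)
  refine tendsto_nhds_unique (hT _)
    ((by simpa [Function.comp_def] using h1 : Tendsto _ _ _).congr' ?_)
  filter_upwards [(Ioo_mem_nhdsLT hδ.2 : Set.Ioo δ 1 ∈ 𝓝[<] (1 : ℝ))] with r hr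
  have h2 : HasNormEval G (fun i => (r : ℂ) • NCModel.ampliation D (lshift i))
      (NCModel.ampliation D (B r)) := by
    simpa only [ampliation_smul] using (hB r hr).ampliation (D := D)
  have := DFunLike.congr_fun ((hP r hr).intertwines (intertwines_smul hC r) h2)
    (htmul (ebasis α) d)
  simpa using this.symm

/-- As `K^* K = 1`, the relation forces `T = K^* A K`. -/
theorem norm_le_of_intertwines [CompleteSpace H] [CompleteSpace E] (K : H →ₗᵢ[ℂ] E)
    {T : H →L[ℂ] H} {A : E →L[ℂ] E}
    (h : T ∘L ContinuousLinearMap.adjoint K.toContinuousLinearMap =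
      ContinuousLinearMap.adjoint K.toContinuousLinearMap ∘L A) : ‖T‖ ≤ ‖A‖ := by
  refine ContinuousLinearMap.opNorm_le_bound _ (norm_nonneg _) fun x => ?_
  have h1 : T x = ContinuousLinearMap.adjoint K.toContinuousLinearMap (A (K x)) := by
    have h2 := DFunLike.congr_fun h (K x)
    have h3 := DFunLike.congr_fun K.adjoint_comp_self x
    simp only [ContinuousLinearMap.comp_apply, LinearIsometry.coe_toContinuousLinearMap,
      one_apply_eq_self] at h2 h3
    rw [← h2, h3]
  have h4 : ‖ContinuousLinearMap.adjoint K.toContinuousLinearMap‖ ≤ 1 := by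
    rw [LinearIsometryEquiv.norm_map]
    exact K.norm_toContinuousLinearMap_le
  rw [h1]
  calc _ ≤ 1 * ‖A (K x)‖ := ContinuousLinearMap.le_of_opNorm_le _ h4 _
    _ ≤ ‖A‖ * ‖x‖ := by rw [one_mul, ← K.norm_map x]; exact A.le_opNorm _

/-- The dilates of a multiplier are bounded by the multiplier. -/
theorem IsMultiplier.norm_le_of_hasNormEval {G : NCSeries n} {W : L2 n →L[ℂ] L2 n}
    (hW : IsMultiplier G W) {r : ℝ} (h0 : 0 ≤ r) (h1 : r ≤ 1) {B : L2 n →L[ℂ] L2 n}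
    (hB : HasNormEval G (fun i => (r : ℂ) • lshift i) B) : ‖B‖ ≤ ‖W‖ :=
  -- The Poisson kernel of the pure row contraction `rS` exhibits `G(rS)` as a compression of `W ⊗
  -- I`.
  (norm_le_of_intertwines _ (hW.intertwines_of_hasSOTEval
    (adjoint_poissonKernel_intertwines (rowNorm_smul_lshift_le h0 h1)
      (isPureRow_smul_lshift h0 h1)) hB.hasSOTEval)).trans (norm_ampliation_le W)

/-- The dilates converge to `W` on the basis and are bounded by `‖W‖`, hence converge strongly. The
threshold `1 / 2` is arbitrary. -/
theorem IsMultiplier.hasRadialEval {G : NCSeries n} {W : L2 n →L[ℂ] L2 n}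
    (hW : IsMultiplier G W) : HasRadialEval G lshift W := by
  have hex : ∀ r : ℝ, ∃ B, r ∈ Set.Ioo (1 / 2 : ℝ) 1 →
      HasNormEval G (fun i => (r : ℂ) • lshift i) B := by
    intro r
    by_cases hr : r ∈ Set.Ioo (1 / 2 : ℝ) 1
    · obtain ⟨B, hB⟩ := exists_hasNormEval_smul_lshift (W (ebasis [])) (r := r)
        (by linarith [hr.1]) hr.2
      exact ⟨B, fun _ => by rwa [hW.symbol_eq]⟩
    · exact ⟨0, fun h => absurd h hr⟩
  choose B hB using hex
  have hδ : (1 / 2 : ℝ) ∈ Set.Ioo (0 : ℝ) 1 := by constructor <;> norm_num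
  refine ⟨B, ⟨1 / 2, hδ, hB⟩, fun x => ?_⟩
  refine tendsto_of_total (C := ‖W‖) ?_ total_ebasis ?_ x
  · filter_upwards [(Ioo_mem_nhdsLT hδ.2 : Set.Ioo (1 / 2) 1 ∈ 𝓝[<] (1 : ℝ))] with r hr
    exact hW.norm_le_of_hasNormEval (by linarith [hr.1]) hr.2.le (hB r hr)
  · rintro _ ⟨α, rfl⟩
    exact hW.tendsto_radial hδ hB α

end Intertwining

/-! ### The model theorem for multiplier tuples -/

section Compression

variable {H E : Type*} [NormedAddCommGroup H] [InnerProductSpace ℂ H] [CompleteSpace H]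
  [NormedAddCommGroup E] [InnerProductSpace ℂ E] [CompleteSpace E]

/-- A unitary onto a closed subspace, as an isometry into the whole space. -/
def subspaceIsometry (M : ClosedSubmodule ℂ E) (U : H ≃ₗᵢ[ℂ] M.toSubmodule) : H →ₗᵢ[ℂ] E :=
  M.toSubmodule.subtypeₗᵢ.comp U.toLinearIsometry

theorem symm_compression_apply (M : ClosedSubmodule ℂ E) (U : H ≃ₗᵢ[ℂ] M.toSubmodule)
    (A : E →L[ℂ] E) (x : H) :
    U.symm (compression M A (U x)) =
      ContinuousLinearMap.adjoint (subspaceIsometry M U).toContinuousLinearMap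
        (A (subspaceIsometry M U x)) := by
  refine ext_inner_left ℂ fun y => ?_
  rw [ContinuousLinearMap.adjoint_inner_right, ← U.inner_map_map, U.apply_symm_apply, compression]
  simp only [ContinuousLinearMap.comp_apply, LinearIsometry.coe_toContinuousLinearMap]
  exact M.toSubmodule.inner_orthogonalProjectionOnto_eq_of_mem_left (U y) _

/-- Co-invariance places `A^* V y` in the range of `V`, say equal to `V w`; then `T^* y = w`, that
is `V T^* = A^* V`, and the claim is the adjoint relation. -/
theorem adjoint_subspaceIsometry_intertwines {M : ClosedSubmodule ℂ E}
    (U : H ≃ₗᵢ[ℂ] M.toSubmodule) {A : E →L[ℂ] E}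
    (hM : ∀ x ∈ M, ContinuousLinearMap.adjoint A x ∈ M) {T : H →L[ℂ] H}
    (hT : ∀ x, T x = U.symm (compression M A (U x))) :
    T ∘L ContinuousLinearMap.adjoint (subspaceIsometry M U).toContinuousLinearMap =
      ContinuousLinearMap.adjoint (subspaceIsometry M U).toContinuousLinearMap ∘L A := by
  ext z
  refine ext_inner_left ℂ fun y => ?_
  set V := subspaceIsometry M U
  obtain ⟨w, hw⟩ := U.surjective ⟨_, hM (V y) (U y).2⟩
  have hVw : V w = ContinuousLinearMap.adjoint A (V y) := congrArg Subtype.val hw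
  have hVV : ∀ x, ContinuousLinearMap.adjoint V.toContinuousLinearMap (V x) = x := fun x =>
    DFunLike.congr_fun V.adjoint_comp_self x
  have hTy : ContinuousLinearMap.adjoint T y = w := by
    refine ext_inner_right ℂ fun x => ?_
    rw [ContinuousLinearMap.adjoint_inner_left, hT, symm_compression_apply,
      ContinuousLinearMap.adjoint_inner_right, ← V.inner_map_map w x, hVw,
      ContinuousLinearMap.adjoint_inner_left]
    rfl
  rw [ContinuousLinearMap.comp_apply, ContinuousLinearMap.comp_apply,
    ← ContinuousLinearMap.adjoint_inner_left, hTy, ContinuousLinearMap.adjoint_inner_right,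
    ContinuousLinearMap.adjoint_inner_right, LinearIsometry.coe_toContinuousLinearMap, hVw,
    ContinuousLinearMap.adjoint_inner_left]

/-- Intertwining holds word by word, so `V^* V = 1` gives `Y_α Y_α^* = V^* A_α A_α^* V`. -/
theorem rowPower_compress {n : ℕ} (V : H →ₗᵢ[ℂ] E) {Y : Fin n → H →L[ℂ] H}
    {A : Fin n → E →L[ℂ] E}
    (h : ∀ i, Y i ∘L ContinuousLinearMap.adjoint V.toContinuousLinearMap =
      ContinuousLinearMap.adjoint V.toContinuousLinearMap ∘L A i) (k : ℕ) :
    rowPower Y k = ContinuousLinearMap.adjoint V.toContinuousLinearMap ∘L rowPower A k ∘L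
      V.toContinuousLinearMap := by
  have h1 : ∀ α, opWord Y α * ContinuousLinearMap.adjoint (opWord Y α) =
      ContinuousLinearMap.adjoint V.toContinuousLinearMap ∘L
        (opWord A α * ContinuousLinearMap.adjoint (opWord A α)) ∘L V.toContinuousLinearMap := by
    intro α
    have h2 := opWord_comp_of_intertwines h α
    have h3 := congrArg ContinuousLinearMap.adjoint h2
    rw [ContinuousLinearMap.adjoint_comp, ContinuousLinearMap.adjoint_comp,
      ContinuousLinearMap.adjoint_adjoint] at h3
    ext x
    have h4 := DFunLike.congr_fun h2
    have h5 := DFunLike.congr_fun h3 x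
    have h6 : ∀ x, ContinuousLinearMap.adjoint V.toContinuousLinearMap
      (V.toContinuousLinearMap x) = x := fun x => DFunLike.congr_fun V.adjoint_comp_self x
    simp only [ContinuousLinearMap.comp_apply, mul_apply_eq_comp] at h4 h5 ⊢
    rw [← h4, ← h5, h6]
  ext x
  simp only [rowPower, h1, sum_apply, ContinuousLinearMap.comp_apply, map_sum]

end Compression

/-! ### Pure tuples as compressions of ampliated multipliers -/

section Model

variable {n : ℕ} {f g : Fin n → NCSeries n} {W : Fin n → L2 n →L[ℂ] L2 n}
  {H : Type u} [NormedAddCommGroup H] [InnerProductSpace ℂ H] [CompleteSpace H]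

theorem poissonKernel_intertwines (hW : ∀ i, IsMultiplier (g i) (W i))
    {T Y : Fin n → H →L[ℂ] H} (hT : HasTupleEval g Y T) (hY : rowNorm Y ≤ 1)
    (hp : IsPureRow Y) (i : Fin n) :
    T i ∘L ContinuousLinearMap.adjoint (poissonKernel hY hp).toContinuousLinearMap =
      ContinuousLinearMap.adjoint (poissonKernel hY hp).toContinuousLinearMap ∘L
        ampliation (defectSpace Y) (W i) := by
  have h := adjoint_poissonKernel_intertwines hY hp
  rcases hT with hT | hT
  · exact (hW i).intertwines_of_hasSOTEval h (hT i)
  · exact (hW i).intertwines_of_hasRadialEval h (hT i)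

theorem poissonKernel_adjoint_apply (hW : ∀ i, IsMultiplier (g i) (W i))
    {T Y : Fin n → H →L[ℂ] H} (hT : HasTupleEval g Y T) (hY : rowNorm Y ≤ 1)
    (hp : IsPureRow Y) (i : Fin n) (h : H) :
    poissonKernel hY hp (ContinuousLinearMap.adjoint (T i) h) =
      ContinuousLinearMap.adjoint (ampliation (defectSpace Y) (W i)) (poissonKernel hY hp h) := by
  have h1 := congrArg ContinuousLinearMap.adjoint (poissonKernel_intertwines hW hT hY hp i)
  rw [ContinuousLinearMap.adjoint_comp, ContinuousLinearMap.adjoint_comp,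
    ContinuousLinearMap.adjoint_adjoint] at h1
  exact DFunLike.congr_fun h1 h

theorem exists_model_of_pure (hW : ∀ i, IsMultiplier (g i) (W i))
    {T Y : Fin n → H →L[ℂ] H} (hT : HasTupleEval g Y T) (hY : rowNorm Y ≤ 1)
    (hp : IsPureRow Y) :
    ∃ (D : Type u) (_ : NormedAddCommGroup D) (_ : InnerProductSpace ℂ D)
      (_ : CompleteSpace D) (M : ClosedSubmodule ℂ (HilbertTensor (L2 n) D)),
      IsCoinvariant M (fun i => ampliation D (W i)) ∧
      UnitarilyEquivalent T (fun i => compression M (ampliation D (W i))) := by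
  have hD : CompleteSpace (defectSpace Y) :=
    (Submodule.isClosed_topologicalClosure _).completeSpace_coe
  set K := poissonKernel hY hp
  -- The model subspace is the range of the Poisson kernel, closed because the kernel is an
  -- isometry.
  have hcl : IsClosed (LinearMap.range K.toLinearMap : Set (HilbertTensor (L2 n) (defectSpace Y))) := by
    rw [LinearMap.coe_range]
    exact K.isometry.isClosedEmbedding.isClosed_range
  let M : ClosedSubmodule ℂ (HilbertTensor (L2 n) (defectSpace Y)) :=
    ⟨LinearMap.range K.toLinearMap, hcl⟩
  refine ⟨defectSpace Y, inferInstance, inferInstance, hD, M, ?_, K.equivRange, fun i x => ?_⟩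
  · rintro i _ ⟨h, rfl⟩
    exact ⟨_, poissonKernel_adjoint_apply hW hT hY hp i h⟩
  · have h1 := DFunLike.congr_fun (poissonKernel_intertwines hW hT hY hp i) (K x)
    have h2 := DFunLike.congr_fun K.adjoint_comp_self x
    simp only [ContinuousLinearMap.comp_apply, LinearIsometry.coe_toContinuousLinearMap,
      one_apply_eq_self] at h1 h2
    refine Eq.trans ?_ (symm_compression_apply M K.equivRange _ x).symm
    exact (congrArg (T i) h2).symm.trans h1

theorem exists_domain_of_model (hW : ∀ i, IsMultiplier (g i) (W i))
    (hf : HasTupleEval f W lshift) {D : Type*} [NormedAddCommGroup D] [InnerProductSpace ℂ D]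
    {M : ClosedSubmodule ℂ (HilbertTensor (L2 n) D)}
    (hM : IsCoinvariant M (fun i => ampliation D (W i))) {T : Fin n → H →L[ℂ] H}
    (hT : UnitarilyEquivalent T (fun i => compression M (ampliation D (W i)))) :
    ∃ Y, HasTupleEval f T Y ∧ HasTupleEval g Y T ∧ rowNorm Y ≤ 1 ∧ IsPureRow Y := by
  obtain ⟨U, hU⟩ := hT
  set V := subspaceIsometry M U
  have hC := fun i => adjoint_subspaceIsometry_intertwines U (hM i) (hU i)
  have hCV : ContinuousLinearMap.adjoint V.toContinuousLinearMap ∘L V.toContinuousLinearMap = 1 :=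
    V.adjoint_comp_self
  -- Compressing `f(W) = S` defines `Y` and also yields `Y_j V^* = V^* (S_j ⊗ I)`; with this second
  -- relation `g(S) = W` can be compressed in turn.
  obtain ⟨h1, h2⟩ := (hf.ampliation (D := D)).compress hCV hC
  have hg : HasTupleEval g lshift W := .inr fun j => (hW j).hasRadialEval
  obtain ⟨h3, -⟩ := (hg.ampliation (D := D)).compress hCV h2
  have h4 := rowPower_compress V h2
  have hV1 : ‖V.toContinuousLinearMap‖ ≤ 1 := V.norm_toContinuousLinearMap_le
  have hV2 : ‖ContinuousLinearMap.adjoint V.toContinuousLinearMap‖ ≤ 1 := by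
    rwa [LinearIsometryEquiv.norm_map]
  refine ⟨_, h1, ?_, ?_, ?_⟩
  · convert h3 with i
    ext x
    rw [hU, symm_compression_apply]
    rfl
  · rw [rowNorm_le_one_iff, h4]
    have h5 := (rowNorm_le_one_iff _).1 (rowNorm_ampliation_lshift_le (n := n) (D := D))
    refine (ContinuousLinearMap.opNorm_comp_le _ _).trans (mul_le_one₀ hV2 (norm_nonneg _) ?_)
    exact (ContinuousLinearMap.opNorm_comp_le _ _).trans (mul_le_one₀ h5 (norm_nonneg _) hV1)
  · rw [isPureRow_iff]
    intro x
    have h5 := (isPureRow_iff _).1 (isPureRow_ampliation_lshift (n := n) (D := D)) (V x)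
    have h6 := ((ContinuousLinearMap.adjoint V.toContinuousLinearMap).continuous.tendsto _).comp h5
    rw [map_zero] at h6
    exact h6.congr fun k => by rw [h4]; rfl

/-- The conclusion of the model theorem when the tuple `(M_{Z_i})` consists of multipliers with
symbols the inverse of `f`, and `f(M_{Z_1}, …, M_{Z_n})` is the tuple of creation operators. -/
theorem model_theorem_of_isMultiplier (c : ModelClass) (f : Fin n → NCSeries n)
    (hW : ∀ i, IsMultiplier (compInverse c f i) (mulZ c f i))
    (hf : HasTupleEval f (mulZ c f) lshift) (T : Fin n → H →L[ℂ] H) :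
    (IsPureElement c f T ↔
      ∃ (D : Type u) (_ : NormedAddCommGroup D) (_ : InnerProductSpace ℂ D)
        (_ : CompleteSpace D) (M : ClosedSubmodule ℂ (HilbertTensor (HardySpace f) D)),
        IsCoinvariant M (fun i => ampliation D (mulZ c f i)) ∧
        UnitarilyEquivalent T (fun i => compression M (ampliation D (mulZ c f i)))) ∧
    (∀ Y : Fin n → H →L[ℂ] H, IsDomainElement c f T Y → IsPureRow Y →
      ∃ K : H →ₗᵢ[ℂ] HilbertTensor (HardySpace f) (defectSpace Y),
        IsPoissonKernel f Y K ∧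
        ∀ i h, K (ContinuousLinearMap.adjoint (T i) h) =
          ContinuousLinearMap.adjoint (ampliation (defectSpace Y) (mulZ c f i)) (K h)) := by
  refine ⟨⟨?_, ?_⟩, fun Y hY hp => ⟨poissonKernel hY.contractive hp,
    hasSum_poissonKernel hY.contractive hp,
    poissonKernel_adjoint_apply hW hY.inverse hY.contractive hp⟩⟩
  · rintro ⟨Y, hY, hp⟩
    exact exists_model_of_pure hW hY.inverse hY.contractive hp
  · rintro ⟨D, _, _, _, M, hM, hT⟩
    obtain ⟨Y, h1, h2, h3, h4⟩ := exists_domain_of_model hW hf hM hT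
    exact ⟨Y, ⟨h1, h2, h3⟩, h4⟩

end Model

/-! ### The algebra of noncommutative power series -/

section Series

variable {n : ℕ}

theorem mulSeries_nil (F G : NCSeries n) : mulSeries F G [] = F [] * G [] := by
  simp [mulSeries]

theorem mulSeries_cons (F G : NCSeries n) (i : Fin n) (β : Word n) :
    mulSeries F G (i :: β) = F [] * G (i :: β) + mulSeries (fun σ => F (i :: σ)) G β := by
  rw [mulSeries, List.length_cons, Finset.sum_range_succ', add_comm]
  simp [mulSeries]

theorem mulSeries_add_left (F F' G : NCSeries n) :
    mulSeries (F + F') G = mulSeries F G + mulSeries F' G := by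
  ext β; simp [mulSeries, add_mul, Finset.sum_add_distrib]

theorem mulSeries_smul_left (c : ℂ) (F G : NCSeries n) :
    mulSeries (c • F) G = c • mulSeries F G := by
  ext β; simp [mulSeries, mul_assoc, Finset.mul_sum]

theorem mulSeries_zero_left (G : NCSeries n) : mulSeries 0 G = 0 := by
  ext β; simp [mulSeries]

theorem mulSeries_zero_right (G : NCSeries n) : mulSeries G 0 = 0 := by
  ext β; simp [mulSeries]

/-- Induction on the word, splitting off its first letter; `F` and `G` must vary, because
`mulSeries_cons` replaces the left factor by its part beginning with that letter. -/
theorem mulSeries_assoc (F G K : NCSeries n) :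
    mulSeries (mulSeries F G) K = mulSeries F (mulSeries G K) := by
  ext β
  induction β generalizing F G with
  | nil => simp [mulSeries_nil, mul_assoc]
  | cons i β ih =>
    have h : (fun σ => mulSeries F G (i :: σ)) =
        F [] • (fun σ => G (i :: σ)) + mulSeries (fun σ => F (i :: σ)) G := by
      ext σ; simp [mulSeries_cons]
    rw [mulSeries_cons, h, mulSeries_add_left, mulSeries_smul_left, mulSeries_cons F,
      mulSeries_cons G, mulSeries_nil, Pi.add_apply, ih, Pi.smul_apply, smul_eq_mul]
    ring

theorem oneSeries_mul (G : NCSeries n) : mulSeries (oneSeries n) G = G := by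
  ext β
  cases β with
  | nil => simp [mulSeries_nil, oneSeries]
  | cons i β =>
    have : (fun σ => oneSeries n (i :: σ)) = 0 := by ext σ; simp [oneSeries]
    rw [mulSeries_cons, this, mulSeries_zero_left]
    simp [oneSeries]

theorem mulSeries_one (F : NCSeries n) : mulSeries F (oneSeries n) = F := by
  ext β
  induction β generalizing F with
  | nil => simp [mulSeries_nil, oneSeries]
  | cons i β ih => simp [mulSeries_cons, ih, oneSeries]

theorem wordSeries_append (f : Fin n → NCSeries n) (α β : Word n) :
    wordSeries f (α ++ β) = mulSeries (wordSeries f α) (wordSeries f β) := by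
  induction α with
  | nil => simp [wordSeries, oneSeries_mul]
  | cons i α ih => simp [wordSeries, ih, mulSeries_assoc]

theorem wordSeries_singleton (f : Fin n → NCSeries n) (i : Fin n) : wordSeries f [i] = f i := by
  simp [wordSeries, mulSeries_one]

theorem coe_ebasis_nil : ((ebasis [] : L2 n) : NCSeries n) = oneSeries n := by
  ext β; simp [ebasis_apply, oneSeries]

theorem coe_ebasis_singleton (i : Fin n) : ((ebasis [i] : L2 n) : NCSeries n) = Z i := by
  ext β; simp [ebasis_apply, Z]

theorem coe_lshift (i : Fin n) (x : L2 n) : (lshift i x : NCSeries n) = mulSeries (Z i) x := by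
  ext β
  cases β with
  | nil => simp [mulSeries_nil, Z]
  | cons j β =>
    rw [mulSeries_cons, lshift_cons]
    by_cases h : i = j
    · subst h
      have : (fun σ => (Z i : NCSeries n) (i :: σ)) = oneSeries n := by
        ext σ; simp [Z, oneSeries]
      rw [this, oneSeries_mul]; simp [Z]
    · have : (fun σ => (Z i : NCSeries n) (j :: σ)) = 0 := by
        ext σ; simp [Z, Ne.symm h]
      rw [this, mulSeries_zero_left]; simp [Z, h]

theorem sum_wordsLT_succ_cons {M : Type*} [AddCommMonoid M] (F : Word n → M) (N : ℕ) :
    ∑ α ∈ wordsLT n (N + 1), F α = F [] + ∑ i, ∑ α ∈ wordsLT n N, F (i :: α) := by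
  simp only [sum_wordsLT]
  rw [Finset.sum_range_succ']
  simp only [sum_ofFn_cons F]
  rw [Finset.sum_comm (s := Finset.univ) (t := Finset.range N), add_comm]
  simp

theorem sum_wordsLT_succ_snoc {M : Type*} [AddCommMonoid M] (F : Word n → M) (N : ℕ) :
    ∑ α ∈ wordsLT n (N + 1), F α = F [] + ∑ i, ∑ α ∈ wordsLT n N, F (α ++ [i]) := by
  simp only [sum_wordsLT]
  rw [Finset.sum_range_succ']
  simp only [sum_ofFn_snoc F]
  rw [Finset.sum_comm (s := Finset.univ) (t := Finset.range N), add_comm]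
  simp

end Series

/-! ### Composition with series vanishing at zero -/

section Composition

variable {n : ℕ} {f : Fin n → NCSeries n}

/-- Without constant terms, each factor `f_i` raises the degree by at least one. This makes the
coefficients of a composition finite sums. -/
theorem wordSeries_eq_zero (hf : ∀ i, f i [] = 0) {α β : Word n} (h : β.length < α.length) :
    wordSeries f α β = 0 := by
  induction α generalizing β with
  | nil => simp at h
  | cons i α ih =>
    rw [wordSeries, mulSeries]
    refine Finset.sum_eq_zero fun k hk => ?_
    cases k with
    | zero => simp [hf]
    | succ k =>
      rw [ih, mul_zero]
      simp at h hk ⊢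
      omega

theorem comp_apply_eq_sum (hf : ∀ i, f i [] = 0) (G : NCSeries n) {β : Word n} {N : ℕ}
    (hN : β.length < N) : comp G f β = ∑ α ∈ wordsLT n N, G α * wordSeries f α β := by
  refine finsum_eq_sum_of_support_subset _ fun α hα => ?_
  rw [Finset.mem_coe, mem_wordsLT]
  by_contra h
  exact hα (by simp only; rw [wordSeries_eq_zero hf (by omega), mul_zero])

theorem mulSeries_comp (hf : ∀ i, f i [] = 0) (F G : NCSeries n) {β : Word n} {N : ℕ}
    (hN : β.length < N) : mulSeries F (comp G f) β =
      ∑ α ∈ wordsLT n N, G α * mulSeries F (wordSeries f α) β := by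
  simp only [mulSeries, Finset.mul_sum]
  rw [Finset.sum_comm]
  refine Finset.sum_congr rfl fun k _ => ?_
  rw [comp_apply_eq_sum hf G (lt_of_le_of_lt (by simp) hN : (β.drop k).length < N),
    Finset.mul_sum]
  exact Finset.sum_congr rfl fun α _ => by ring

theorem comp_mulSeries (hf : ∀ i, f i [] = 0) (F G : NCSeries n) {β : Word n} {N : ℕ}
    (hN : β.length < N) : mulSeries (comp G f) F β =
      ∑ α ∈ wordsLT n N, G α * mulSeries (wordSeries f α) F β := by
  simp only [mulSeries, Finset.mul_sum]
  rw [Finset.sum_comm]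
  refine Finset.sum_congr rfl fun k _ => ?_
  rw [comp_apply_eq_sum hf G (lt_of_le_of_lt (by simp) hN : (β.take k).length < N),
    Finset.sum_mul]
  exact Finset.sum_congr rfl fun α _ => by ring

theorem comp_eq_cons (hf : ∀ i, f i [] = 0) (G : NCSeries n) :
    comp G f = G [] • oneSeries n + ∑ i, mulSeries (f i) (comp (fun σ => G (i :: σ)) f) := by
  ext β
  rw [comp_apply_eq_sum hf G (show β.length < β.length + 1 + 1 by omega), sum_wordsLT_succ_cons]
  simp only [Pi.add_apply, Pi.smul_apply, smul_eq_mul, Finset.sum_apply]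
  congr 1
  refine Finset.sum_congr rfl fun i _ => ?_
  rw [mulSeries_comp hf _ _ (Nat.lt_succ_self _)]
  rfl

theorem comp_eq_snoc (hf : ∀ i, f i [] = 0) (G : NCSeries n) :
    comp G f = G [] • oneSeries n + ∑ i, mulSeries (comp (fun σ => G (σ ++ [i])) f) (f i) := by
  ext β
  rw [comp_apply_eq_sum hf G (show β.length < β.length + 1 + 1 by omega), sum_wordsLT_succ_snoc]
  simp only [Pi.add_apply, Pi.smul_apply, smul_eq_mul, Finset.sum_apply]
  congr 1
  refine Finset.sum_congr rfl fun i _ => ?_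
  rw [comp_mulSeries hf _ _ (Nat.lt_succ_self _)]
  simp only [wordSeries_append, wordSeries_singleton]

theorem comp_zero_left (f : Fin n → NCSeries n) : comp 0 f = 0 := by
  ext β; simp [comp]

theorem comp_sub (hf : ∀ i, f i [] = 0) (F G : NCSeries n) :
    comp (F - G) f = comp F f - comp G f := by
  ext β
  simp [comp_apply_eq_sum hf _ (Nat.lt_succ_self β.length), sub_mul]

theorem comp_lshift (hf : ∀ i, f i [] = 0) (j : Fin n) (x : L2 n) :
    comp (lshift j x) f = mulSeries (f j) (comp x f) := by
  rw [comp_eq_cons hf, Finset.sum_eq_single j]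
  · simp
  · intro i _ hi
    have : (fun σ => lshift j x (i :: σ)) = 0 := by ext σ; simp [hi.symm]
    rw [this, comp_zero_left, mulSeries_zero_right]
  · simp

theorem comp_rshift (hf : ∀ i, f i [] = 0) (j : Fin n) (x : L2 n) :
    comp (rshift j x) f = mulSeries (comp x f) (f j) := by
  rw [comp_eq_snoc hf, Finset.sum_eq_single j]
  · simp
  · intro i _ hi
    have : (fun σ => rshift j x (σ ++ [i])) = 0 := by ext σ; simp [hi.symm]
    rw [this, comp_zero_left, mulSeries_zero_left]
  · simp

theorem comp_ebasis_nil (hf : ∀ i, f i [] = 0) :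
    comp (ebasis [] : L2 n) f = oneSeries n := by
  rw [comp_eq_cons hf, Finset.sum_eq_zero]
  · simp [ebasis_apply]
  · intro i _
    have : (fun σ => (ebasis [] : L2 n) (i :: σ)) = 0 := by ext σ; simp [ebasis_apply]
    rw [this, comp_zero_left, mulSeries_zero_right]

/-- Series with invertible linear part are right linearly independent. -/
theorem eq_zero_of_sum_mulSeries_eq_zero (hf : ∀ i, f i [] = 0) (hJ : (jacobianZero f).det ≠ 0)
    {h : Fin n → NCSeries n} (h0 : ∑ i, mulSeries (f i) (h i) = 0) (i : Fin n) : h i = 0 := by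
  have key : ∀ (m : ℕ) (β : Word n), β.length = m → ∀ i, h i β = 0 := by
    intro m
    induction m using Nat.strong_induction_on with
    | _ m ih =>
      intro β hβ
      have h1 : ∀ (F : NCSeries n) i, mulSeries F (h i) β = F [] * h i β := by
        intro F i
        rw [mulSeries, Finset.sum_range_succ', Finset.sum_eq_zero]
        · simp
        · intro k hk
          rw [Finset.mem_range] at hk
          rw [ih (β.drop (k + 1)).length (by simp; omega) _ rfl, mul_zero]
      -- If all shorter coefficients of the `h i` vanish, the coefficient of `jβ` in `∑ f_i h_i` is
      -- `∑_i f_i[j] h_i(β)`: a row vector times the Jacobian matrix.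
      have h2 : Matrix.vecMul (fun i => h i β) (jacobianZero f) = 0 := by
        ext j
        have := congrFun h0 (j :: β)
        simp only [Finset.sum_apply, mulSeries_cons, hf, zero_mul, zero_add, h1] at this
        simpa [Matrix.vecMul, dotProduct, jacobianZero, mul_comm] using this
      exact congrFun (Matrix.eq_zero_of_vecMul_eq_zero hJ h2)
  ext β
  exact key _ β rfl i

/-- The constant term of `G ∘ f` is that of `G`. Once it vanishes, `G ∘ f = ∑ f_i (G_i ∘ f)`, where
`G_i` collects the coefficients of words starting with `i`; independence kills each `G_i ∘ f`, and
one letter has been removed. -/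
theorem eq_zero_of_comp_eq_zero (hf : ∀ i, f i [] = 0) (hJ : (jacobianZero f).det ≠ 0)
    {G : NCSeries n} (hG : comp G f = 0) : G = 0 := by
  ext α
  induction α generalizing G with
  | nil =>
    have := congrFun hG []
    rw [comp_eq_cons hf] at this
    simpa [mulSeries_nil, hf, oneSeries] using this
  | cons i α ih =>
    have h0 : G [] = 0 := by
      have := congrFun hG []
      rw [comp_eq_cons hf] at this
      simpa [mulSeries_nil, hf, oneSeries] using this
    rw [comp_eq_cons hf, h0, zero_smul, zero_add] at hG
    exact ih (eq_zero_of_sum_mulSeries_eq_zero hf hJ hG i)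

theorem comp_injective (hf : ∀ i, f i [] = 0) (hJ : (jacobianZero f).det ≠ 0)
    {F G : NCSeries n} (h : comp F f = comp G f) : F = G :=
  sub_eq_zero.1 (eq_zero_of_comp_eq_zero hf hJ (by rw [comp_sub hf, h, sub_self]))

/-- After composing with `f`, the symbol condition reads `M_{Z_i} 1 = Z_i = g_i ∘ f`, and the
commutation is associativity of `Z_i · x · f_j`. -/
theorem PropertyS.isMultiplier (hf : PropertyS f) (i : Fin n) :
    IsMultiplier (compInverse .powerSeries f i) (mulZ .powerSeries f i) := by
  have hM : IsLeftMul .powerSeries f (Z i) (mulZ .powerSeries f i) :=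
    Classical.epsilon_spec (hf.multiplier i)
  have hg : IsCompInverse .powerSeries f (compInverse .powerSeries f) := by
    choose a ha using hf.mem
    exact Classical.epsilon_spec (p := IsCompInverse .powerSeries f) ⟨fun i => a i, ha⟩
  refine ⟨fun β => congrFun (comp_injective hf.zero hf.jacobian ?_) β, fun j => ?_⟩
  · rw [hM, comp_ebasis_nil hf.zero, mulSeries_one, hg i]
  · ext x : 1
    refine lp.ext (comp_injective hf.zero hf.jacobian ?_)
    rw [ContinuousLinearMap.comp_apply, ContinuousLinearMap.comp_apply, hM,
      comp_rshift hf.zero, comp_rshift hf.zero, hM, mulSeries_assoc]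

theorem PropertyS.hasTupleEval (hf : PropertyS f) :
    HasTupleEval f (mulZ .powerSeries f) lshift := by
  obtain ⟨A, hA, hL⟩ := hf.mul_eq_eval
  have : A = lshift := by
    ext j x : 2
    refine lp.ext (comp_injective hf.zero hf.jacobian ?_)
    rw [hL j x, comp_lshift hf.zero]
  exact this ▸ hA

end Composition

/-! ### Free holomorphic functions -/

section Radius

variable {n : ℕ}

/-- This form, free of roots and of the limsup, is easy to check for differences of series. -/
theorem invRadius_le_one_iff (G : NCSeries n) : invRadius G ≤ 1 ↔
    ∀ q : ℝ, 1 < q → ∀ᶠ k : ℕ in atTop, ∑ w : Fin k → Fin n, ‖G (List.ofFn w)‖ ^ 2 ≤ q ^ k := by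
  -- For `k = 0` the exponent `1 / (2 k)` takes the value `0`, so that degree is excluded.
  have hpow : ∀ (k : ℕ), k ≠ 0 → ∀ s : ℝ, 0 ≤ s → (s ^ (2 * k)) ^ (1 / (2 * (k : ℝ))) = s := by
    intro k hk s hs
    have := Real.pow_rpow_inv_natCast hs (n := 2 * k) (by omega)
    simpa using this
  constructor
  · intro h q hq
    have hs : 1 < √q := by rw [Real.lt_sqrt] <;> linarith
    have h1 : invRadius G < ENNReal.ofReal √q := h.trans_lt (by simpa using hs)
    filter_upwards [eventually_lt_of_limsup_lt h1, eventually_ne_atTop 0] with k hk hk0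
    have h2 := (ENNReal.ofReal_lt_ofReal_iff (by linarith)).1 hk
    have h3 : √q ^ (2 * k) = q ^ k := by rw [pow_mul, Real.sq_sqrt (by linarith)]
    rw [← hpow k hk0 (√q) (by positivity)] at h2
    rw [← h3]
    exact ((Real.rpow_lt_rpow_iff (by positivity) (by positivity) (by positivity)).1 h2).le
  · intro h
    refine ENNReal.le_of_forall_pos_le_add fun ε hε _ => ?_
    have hs : (1 : ℝ) < 1 + ε := by simpa using hε
    refine limsup_le_of_le (by isBoundedDefault) ?_
    filter_upwards [h ((1 + ε) ^ 2) (by nlinarith), eventually_ne_atTop 0] with k hk hk0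
    have h1 : ENNReal.ofReal (1 + ε) = 1 + ε := by
      rw [ENNReal.ofReal_add zero_le_one ε.coe_nonneg]; simp
    rw [← h1]
    refine ENNReal.ofReal_le_ofReal ?_
    rw [← pow_mul] at hk
    rw [← hpow k hk0 (1 + ε) (by positivity)]
    exact Real.rpow_le_rpow (by positivity) hk (by positivity)

theorem invRadius_le_one_of_l2 (x : L2 n) : invRadius (x : NCSeries n) ≤ 1 := by
  rw [invRadius_le_one_iff]
  intro q hq
  filter_upwards [(tendsto_pow_atTop_atTop_of_one_lt hq).eventually_ge_atTop (‖x‖ ^ 2)] with k hk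
  exact (sum_norm_sq_le x k).trans hk

theorem invRadius_sub_le_one {F G : NCSeries n} (hF : invRadius F ≤ 1) (hG : invRadius G ≤ 1) :
    invRadius (F - G) ≤ 1 := by
  rw [invRadius_le_one_iff] at *
  intro q hq
  -- Both series are compared with `√q ^ k`; the spare factor `√q ^ k` eventually absorbs the
  -- constant `4`.
  have hs : 1 < √q := by rw [Real.lt_sqrt] <;> linarith
  filter_upwards [hF _ hs, hG _ hs,
    (tendsto_pow_atTop_atTop_of_one_lt hs).eventually_ge_atTop 4] with k h1 h2 h3
  have h4 : q ^ k = √q ^ k * √q ^ k := by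
    rw [← mul_pow, Real.mul_self_sqrt (by linarith)]
  calc _ ≤ ∑ w : Fin k → Fin n, (2 * ‖F (List.ofFn w)‖ ^ 2 + 2 * ‖G (List.ofFn w)‖ ^ 2) := by
        refine Finset.sum_le_sum fun w _ => ?_
        have h5 : ‖(F - G) (List.ofFn w)‖ ≤ ‖F (List.ofFn w)‖ + ‖G (List.ofFn w)‖ :=
          norm_sub_le _ _
        have h6 := norm_nonneg ((F - G) (List.ofFn w))
        nlinarith [sq_nonneg (‖F (List.ofFn w)‖ - ‖G (List.ofFn w)‖)]
    _ ≤ 4 * √q ^ k := by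
        rw [Finset.sum_add_distrib, ← Finset.mul_sum, ← Finset.mul_sum]; linarith
    _ ≤ q ^ k := by rw [h4]; gcongr

end Radius

/-! ### Evaluations in the unit ball and the free holomorphic case -/

section FreeHolomorphic

variable {n : ℕ} {H : Type*} [NormedAddCommGroup H] [InnerProductSpace ℂ H]
  {Y : Fin n → H →L[ℂ] H}

theorem HasNormEval.sub {F G : NCSeries n} {A B : H →L[ℂ] H} (hF : HasNormEval F Y A)
    (hG : HasNormEval G Y B) : HasNormEval (F - G) Y (A - B) :=
  (Tendsto.sub hF hG).congr fun N => (partialSum_sub F G Y N).symm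

theorem HasNormEval.lshift {x : L2 n} {B : H →L[ℂ] H} (h : HasNormEval (x : NCSeries n) Y B)
    (j : Fin n) : HasNormEval (lshift j x : NCSeries n) Y (Y j * B) := by
  -- Creation raises the degree by one, so the partial sum up to `N + 1` is `Y_j` times the one up
  -- to `N`.
  refine (tendsto_add_atTop_iff_nat 1).1 ((Tendsto.const_mul (Y j) h).congr fun N => ?_)
  rw [partialSum_eq_sum_wordsLT, partialSum_eq_sum_wordsLT, sum_wordsLT_succ_cons,
    Finset.sum_eq_single j]
  · simp [Finset.mul_sum]
  · intro i _ hi; simp [hi.symm]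
  · simp

theorem HasNormEval.rshift {x : L2 n} {B : H →L[ℂ] H} (h : HasNormEval (x : NCSeries n) Y B)
    (j : Fin n) : HasNormEval (rshift j x : NCSeries n) Y (B * Y j) := by
  refine (tendsto_add_atTop_iff_nat 1).1 ((Tendsto.mul_const (Y j) h).congr fun N => ?_)
  rw [partialSum_eq_sum_wordsLT, partialSum_eq_sum_wordsLT, sum_wordsLT_succ_snoc,
    Finset.sum_eq_single j]
  · simp [Finset.sum_mul, opWord_append]
  · intro i _ hi; simp [hi.symm]
  · simp

theorem hasNormEval_ebasis_nil (Y : Fin n → H →L[ℂ] H) :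
    HasNormEval ((ebasis [] : L2 n) : NCSeries n) Y 1 := by
  refine (tendsto_add_atTop_iff_nat 1).1 (tendsto_const_nhds.congr fun N => ?_)
  rw [partialSum_eq_sum_wordsLT, sum_wordsLT_succ_cons]
  simp [ebasis_apply]

theorem hasNormEval_Z (Y : Fin n → H →L[ℂ] H) (i : Fin n) : HasNormEval (Z i) Y (Y i) := by
  have := (hasNormEval_ebasis_nil Y).lshift i
  rwa [lshift_ebasis, coe_ebasis_singleton, mul_one] at this

theorem HasNormEval.unique {G : NCSeries n} {A B : H →L[ℂ] H} (hA : HasNormEval G Y A)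
    (hB : HasNormEval G Y B) : A = B := tendsto_nhds_unique hA hB

variable {γ : ℝ} {f : Fin n → NCSeries n}

/-- The condition `G ∘ f ≠ 0` for `G ≠ 0`, applied to a difference, is injectivity of composition
with `f`. -/
theorem PropertyF.series_eq (hf : PropertyF γ f) {F G : NCSeries n} (hF : invRadius F ≤ 1)
    (hG : invRadius G ≤ 1)
    (h : ∀ X ∈ opBall n γ, ∀ Y, (∀ j, HasNormEval (f j) X (Y j)) →
      ∃ B, HasNormEval F Y B ∧ HasNormEval G Y B) : F = G := by
  refine sub_eq_zero.1 (hf.not_right_zero_divisor _ (invRadius_sub_le_one hF hG)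
    fun X hX Y hY => ?_)
  obtain ⟨B, h1, h2⟩ := h X hX Y hY
  simpa using h1.sub h2

theorem PropertyF.isMultiplier (hf : PropertyF γ f) (i : Fin n) :
    IsMultiplier (compInverse (.freeHolomorphic γ) f i) (mulZ (.freeHolomorphic γ) f i) := by
  have hM : IsLeftMul (.freeHolomorphic γ) f (Z i) (mulZ (.freeHolomorphic γ) f i) :=
    Classical.epsilon_spec (hf.multiplier i)
  have hg : IsCompInverse (.freeHolomorphic γ) f (compInverse (.freeHolomorphic γ) f) := by
    choose a ha using hf.mem
    exact Classical.epsilon_spec (p := IsCompInverse (.freeHolomorphic γ) f)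
      ⟨fun i => a i, fun i => invRadius_le_one_of_l2 (a i), fun X hX Y hY i => ha i X hX Y hY⟩
  refine ⟨fun β => congrFun (hf.series_eq (invRadius_le_one_of_l2 _) (hg.1 i)
    fun X hX Y hY => ⟨X i, ?_, hg.2 X hX Y hY i⟩) β, fun j => ?_⟩
  · obtain ⟨B, h1, h2⟩ := hM (ebasis []) X hX Y (X i) hY (hasNormEval_Z X i)
    rwa [h1.unique (hasNormEval_ebasis_nil Y), mul_one] at h2
  · ext x : 1
    refine lp.ext (hf.series_eq (invRadius_le_one_of_l2 _) (invRadius_le_one_of_l2 _)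
      fun X hX Y hY => ?_)
    -- With `B = x(Y)`, the two orders of multiplication have the values `X_i (B Y_j)` and `(X_i B)
    -- Y_j` at every point of the ball.
    obtain ⟨B, h1, h2⟩ := hM x X hX Y (X i) hY (hasNormEval_Z X i)
    obtain ⟨B', h3, h4⟩ := hM (rshift j x) X hX Y (X i) hY (hasNormEval_Z X i)
    rw [h3.unique (h1.rshift j), ← mul_assoc] at h4
    exact ⟨_, h4, h2.rshift j⟩

theorem PropertyF.hasTupleEval (hf : PropertyF γ f) :
    HasTupleEval f (mulZ (.freeHolomorphic γ) f) lshift := by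
  obtain ⟨A, hA, hL⟩ := hf.mul_eq_eval
  have : A = NCModel.lshift := by
    ext j x : 2
    refine lp.ext (hf.series_eq (invRadius_le_one_of_l2 _) (invRadius_le_one_of_l2 _)
      fun X hX Y hY => ?_)
    obtain ⟨B, h1, h2⟩ := hL j x X hX Y (Y j) hY (hY j)
    exact ⟨_, h2, h1.lshift j⟩
  exact this ▸ hA

end FreeHolomorphic

/-! ### Polynomial tuples -/

section Polynomial

variable {n : ℕ}

/-- The word `α` as an element of the free algebra. -/
def freeWord (α : Word n) : FreeAlgebra ℂ (Fin n) := (α.map (FreeAlgebra.ι ℂ)).prod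

theorem lift_freeWord {A : Type*} [Ring A] [Algebra ℂ A] (X : Fin n → A) (α : Word n) :
    FreeAlgebra.lift ℂ X (freeWord α) = (α.map X).prod := by
  rw [freeWord, map_list_prod, List.map_map]
  congr 2
  ext i
  simp

theorem span_freeWord : Submodule.span ℂ (Set.range (freeWord : Word n → _)) = ⊤ := by
  set P := Submodule.span ℂ (Set.range (freeWord : Word n → FreeAlgebra ℂ (Fin n)))
  have h1 : (1 : FreeAlgebra ℂ (Fin n)) ∈ P := Submodule.subset_span ⟨[], rfl⟩
  refine Submodule.eq_top_iff'.2 fun p => ?_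
  induction p using FreeAlgebra.induction with
  | grade0 c => rw [Algebra.algebraMap_eq_smul_one]; exact P.smul_mem c h1
  | grade1 i => exact Submodule.subset_span ⟨[i], by simp [freeWord]⟩
  | add p q hp hq => exact P.add_mem hp hq
  | mul p q hp hq =>
    have h2 := Submodule.mul_mem_mul hp hq
    rw [Submodule.span_mul_span] at h2
    refine Submodule.span_mono ?_ h2
    rintro _ ⟨_, ⟨α, rfl⟩, _, ⟨β, rfl⟩, rfl⟩
    exact ⟨α ++ β, by simp [freeWord]⟩

@[elab_as_elim]
theorem freeWord_induction {C : FreeAlgebra ℂ (Fin n) → Prop} (word : ∀ α, C (freeWord α))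
    (zero : C 0) (add : ∀ p q, C p → C q → C (p + q)) (smul : ∀ (c : ℂ) p, C p → C (c • p))
    (p : FreeAlgebra ℂ (Fin n)) : C p := by
  have hp : p ∈ Submodule.span ℂ (Set.range (freeWord : Word n → _)) := by
    rw [span_freeWord]; trivial
  induction hp using Submodule.span_induction with
  | mem p hp => obtain ⟨α, rfl⟩ := hp; exact word α
  | zero => exact zero
  | add p q _ _ hp hq => exact add p q hp hq
  | smul c p _ hp => exact smul c p hp

/-- Evaluation of a polynomial at the creation operators. -/
def shiftEval : FreeAlgebra ℂ (Fin n) →ₐ[ℂ] (L2 n →L[ℂ] L2 n) := FreeAlgebra.lift ℂ lshift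

/-- The coefficients of a polynomial. -/
def polySeries : FreeAlgebra ℂ (Fin n) →ₗ[ℂ] NCSeries n where
  toFun p := (shiftEval p (ebasis []) : L2 n)
  map_add' p q := by simp; rfl
  map_smul' c p := by simp

theorem coe_shiftEval_nil (p : FreeAlgebra ℂ (Fin n)) :
    (shiftEval p (ebasis []) : NCSeries n) = polySeries p := rfl

theorem shiftEval_freeWord (α : Word n) : shiftEval (freeWord α) = opWord lshift α :=
  lift_freeWord _ _

theorem polySeries_freeWord (α : Word n) :
    polySeries (freeWord α) = (ebasis α : L2 n) := by
  rw [← coe_shiftEval_nil, shiftEval_freeWord, opWord_lshift_ebasis, List.append_nil]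

theorem polySeries_ι (i : Fin n) : polySeries (FreeAlgebra.ι ℂ i) = Z i := by
  rw [← coe_ebasis_singleton, ← polySeries_freeWord]; simp [freeWord]

theorem coe_shiftEval (p : FreeAlgebra ℂ (Fin n)) (x : L2 n) :
    (shiftEval p x : NCSeries n) = mulSeries (polySeries p) x := by
  induction p using FreeAlgebra.induction generalizing x with
  | grade0 c =>
    rw [← coe_shiftEval_nil, Algebra.algebraMap_eq_smul_one, map_smul, map_one]
    simp only [smul_apply, one_apply_eq_self, lp.coeFn_smul, coe_ebasis_nil, mulSeries_smul_left,
      oneSeries_mul]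
  | grade1 i => rw [polySeries_ι, ← coe_lshift]; simp [shiftEval]
  | add p q hp hq =>
    rw [map_add, map_add, mulSeries_add_left, ← hp, ← hq]; rfl
  | mul p q hp hq =>
    have h : polySeries (p * q) = mulSeries (polySeries p) (polySeries q) := by
      rw [← coe_shiftEval_nil, map_mul, mul_apply_eq_comp, hp, coe_shiftEval_nil]
    rw [h, map_mul, mul_apply_eq_comp, hp, hq, mulSeries_assoc]

theorem polySeries_mul (p q : FreeAlgebra ℂ (Fin n)) :
    polySeries (p * q) = mulSeries (polySeries p) (polySeries q) := by
  rw [← coe_shiftEval_nil, map_mul, mul_apply_eq_comp, coe_shiftEval, coe_shiftEval_nil]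

theorem isPolynomial_polySeries (p : FreeAlgebra ℂ (Fin n)) : IsPolynomial (polySeries p) := by
  induction p using freeWord_induction with
  | word α =>
    rw [polySeries_freeWord]
    refine (Set.finite_singleton α).subset fun β hβ => ?_
    by_contra h
    exact hβ (by rw [ebasis_apply, if_neg (by simpa using h)])
  | zero => simp [IsPolynomial]
  | add p q hp hq =>
    rw [map_add]
    exact (hp.union hq).subset (Function.support_add _ _)
  | smul c p hp =>
    rw [map_smul]
    exact hp.subset (Function.support_const_smul_subset c _)

theorem IsPolynomial.exists_polySeries {G : NCSeries n} (hG : IsPolynomial G) :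
    ∃ p, polySeries p = G := by
  refine ⟨∑ α ∈ hG.toFinset, G α • freeWord α, ?_⟩
  ext β
  simp only [map_sum, map_smul, polySeries_freeWord, Finset.sum_apply, Pi.smul_apply,
    ebasis_apply, smul_eq_mul, mul_ite, mul_one, mul_zero, Finset.sum_ite_eq]
  by_cases h : G β = 0 <;> simp [h, Set.Finite.mem_toFinset hG]

theorem polySeries_one : polySeries (1 : FreeAlgebra ℂ (Fin n)) = oneSeries n := by
  rw [← coe_ebasis_nil, ← polySeries_freeWord]; rfl

theorem wordSeries_polySeries (F : Fin n → FreeAlgebra ℂ (Fin n)) (α : Word n) :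
    wordSeries (fun i => polySeries (F i)) α = polySeries (α.map F).prod := by
  induction α with
  | nil => simp [wordSeries, polySeries_one]
  | cons i α ih => simp [wordSeries, ih, polySeries_mul]

theorem comp_add_of_isPolynomial {F G : NCSeries n} (hF : IsPolynomial F) (hG : IsPolynomial G)
    (f : Fin n → NCSeries n) : comp (F + G) f = comp F f + comp G f := by
  ext β
  simp only [comp, Pi.add_apply, add_mul]
  exact finsum_add_distrib (hF.subset (Function.support_mul_subset_left _ _))
    (hG.subset (Function.support_mul_subset_left _ _))

theorem comp_smul (c : ℂ) (G : NCSeries n) (f : Fin n → NCSeries n) :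
    comp (c • G) f = c • comp G f := by
  ext β
  simp only [comp, Pi.smul_apply, smul_eq_mul, mul_assoc]
  rw [← smul_eq_mul, smul_finsum]
  rfl

theorem comp_ebasis (α : Word n) (f : Fin n → NCSeries n) :
    comp (ebasis α : L2 n) f = wordSeries f α := by
  ext β
  rw [comp, finsum_eq_single _ α fun γ hγ => by rw [ebasis_apply, if_neg hγ, zero_mul]]
  simp [ebasis_apply]

/-- Substitution of polynomials is composition of their series. -/
theorem comp_polySeries (F : Fin n → FreeAlgebra ℂ (Fin n)) (p : FreeAlgebra ℂ (Fin n)) :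
    comp (polySeries p) (fun i => polySeries (F i)) = polySeries (FreeAlgebra.lift ℂ F p) := by
  induction p using freeWord_induction with
  | word α => rw [polySeries_freeWord, comp_ebasis, wordSeries_polySeries, lift_freeWord]
  | zero => simp only [map_zero]; exact comp_zero_left _
  | add p q hp hq =>
    rw [map_add, comp_add_of_isPolynomial (isPolynomial_polySeries p) (isPolynomial_polySeries q),
      hp, hq, map_add, map_add]
  | smul c p hp => rw [map_smul, comp_smul, hp, map_smul, map_smul]

/-- The partial sums of a polynomial are eventually equal to its value. -/
theorem eventually_partialSum_polySeries {H : Type*} [NormedAddCommGroup H]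
    [InnerProductSpace ℂ H] (X : Fin n → H →L[ℂ] H) (p : FreeAlgebra ℂ (Fin n)) :
    ∀ᶠ N in atTop, partialSum (polySeries p) X N = FreeAlgebra.lift ℂ X p := by
  simp only [partialSum_eq_sum_wordsLT]
  induction p using freeWord_induction with
  | word α =>
    filter_upwards [eventually_gt_atTop α.length] with N hN
    rw [polySeries_freeWord, lift_freeWord]
    simp [ebasis_apply, hN, opWord]
  | zero => simp
  | add p q hp hq =>
    filter_upwards [hp, hq] with N h1 h2
    simp [add_smul, Finset.sum_add_distrib, h1, h2]
  | smul c p hp =>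
    filter_upwards [hp] with N h1
    simp [mul_smul, ← Finset.smul_sum, h1]

theorem hasSOTEval_polySeries {H : Type*} [NormedAddCommGroup H]
    [InnerProductSpace ℂ H] (X : Fin n → H →L[ℂ] H) (p : FreeAlgebra ℂ (Fin n)) :
    HasSOTEval (polySeries p) X (FreeAlgebra.lift ℂ X p) := fun x =>
  tendsto_const_nhds.congr' <| (eventually_partialSum_polySeries X p).mono fun N hN => by simp only [hN]

/-- The operator `p(S)` is left multiplication by the series of `p`; equalities of series thus
become operator identities without being lifted to the free algebra. -/
theorem shiftEval_eq_of_polySeries_eq {p q : FreeAlgebra ℂ (Fin n)}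
    (h : polySeries p = polySeries q) : shiftEval p = shiftEval q := by
  ext x : 1
  exact lp.ext (by rw [coe_shiftEval, coe_shiftEval, h])

theorem shiftEval_comp_rshift (p : FreeAlgebra ℂ (Fin n)) (j : Fin n) :
    shiftEval p ∘L rshift j = rshift j ∘L shiftEval p := by
  -- `p(S)` equals one of its own partial sums, which commute with right creation operators.
  obtain ⟨N, hN⟩ := (eventually_partialSum_polySeries lshift p).exists
  rw [shiftEval, ← hN]
  exact partialSum_comp_of_intertwines (fun i => lshift_comp_rshift i j) _ N

/-! ### Polynomial tuples with a polynomial inverse -/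

section Inverse

variable {F Q : Fin n → FreeAlgebra ℂ (Fin n)}

/-- `F(Q(S)) = (F ∘ Q)(S) = S`, by functoriality of substitution. -/
theorem lift_shiftEval_of_comp_eq
    (hFQ : ∀ i, comp (polySeries (F i)) (fun i => polySeries (Q i)) = Z i) (i : Fin n) :
    FreeAlgebra.lift ℂ (fun k => shiftEval (Q k)) (F i) = lshift i := by
  have h1 := hFQ i
  rw [comp_polySeries, ← polySeries_ι] at h1
  have h2 := shiftEval_eq_of_polySeries_eq h1
  have h3 : shiftEval.comp (FreeAlgebra.lift ℂ Q) =
      FreeAlgebra.lift ℂ (fun k => shiftEval (Q k)) := by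
    ext k; simp
  rw [← h3]
  simpa [shiftEval] using h2

/-- Since `f(0) = 0` is not assumed here, no degree argument applies. Instead both compositions are
evaluated at `W = Q(S)`: as `F(W) = S`, this gives `p(S) = q(S)`, and applying both to `e_∅`
recovers the coefficients. -/
theorem polySeries_eq_of_comp_eq
    (hFQ : ∀ i, comp (polySeries (F i)) (fun i => polySeries (Q i)) = Z i)
    {G G' : NCSeries n} (hG : IsPolynomial G) (hG' : IsPolynomial G')
    (h : comp G (fun i => polySeries (F i)) = comp G' (fun i => polySeries (F i))) : G = G' := by
  obtain ⟨p, rfl⟩ := hG.exists_polySeries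
  obtain ⟨q, rfl⟩ := hG'.exists_polySeries
  rw [comp_polySeries, comp_polySeries] at h
  set W : Fin n → L2 n →L[ℂ] L2 n := fun k => shiftEval (Q k)
  have h1 : (FreeAlgebra.lift ℂ W).comp (FreeAlgebra.lift ℂ F) = shiftEval := by
    ext k : 2
    simpa [shiftEval, W] using lift_shiftEval_of_comp_eq hFQ k
  obtain ⟨N, hp, hq⟩ := ((eventually_partialSum_polySeries W (FreeAlgebra.lift ℂ F p)).and
    (eventually_partialSum_polySeries W (FreeAlgebra.lift ℂ F q))).exists
  rw [h, hq] at hp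
  have h2 : shiftEval p = shiftEval q := by
    rw [← h1]; exact hp.symm
  rw [← coe_shiftEval_nil, h2, coe_shiftEval_nil]

theorem isLeftMul_shiftEval
    (hQF : ∀ i, comp (polySeries (Q i)) (fun i => polySeries (F i)) = Z i) (i : Fin n) :
    IsLeftMul .polynomial (fun i => polySeries (F i)) (Z i) (shiftEval (Q i)) := by
  intro a ha
  obtain ⟨p, hp⟩ := ha.exists_polySeries
  have h : (shiftEval (Q i) a : NCSeries n) = polySeries (Q i * p) := by
    rw [coe_shiftEval, ← hp, polySeries_mul]
  rw [h]
  refine ⟨isPolynomial_polySeries _, ?_⟩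
  rw [← hp, comp_polySeries, comp_polySeries, map_mul, polySeries_mul, ← hQF, comp_polySeries]

/-- Left multiplication is prescribed only on polynomials, but these contain the basis vectors,
which determine a bounded operator. -/
theorem mulZ_polynomial_eq
    (hFQ : ∀ i, comp (polySeries (F i)) (fun i => polySeries (Q i)) = Z i)
    (hQF : ∀ i, comp (polySeries (Q i)) (fun i => polySeries (F i)) = Z i) (i : Fin n) :
    mulZ .polynomial (fun i => polySeries (F i)) i = shiftEval (Q i) := by
  have h1 := isLeftMul_shiftEval hQF i
  have h2 : IsLeftMul .polynomial (fun i => polySeries (F i)) (Z i)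
      (mulZ .polynomial (fun i => polySeries (F i)) i) := Classical.epsilon_spec ⟨_, h1⟩
  refine ext_ebasis fun α => lp.ext ?_
  have hα : IsPolynomial ((ebasis α : L2 n) : NCSeries n) := by
    rw [← polySeries_freeWord]; exact isPolynomial_polySeries _
  obtain ⟨h3, h4⟩ := h1 _ hα
  obtain ⟨h5, h6⟩ := h2 _ hα
  exact polySeries_eq_of_comp_eq hFQ h5 h3 (h6.trans h4.symm)

theorem compInverse_polynomial_eq
    (hFQ : ∀ i, comp (polySeries (F i)) (fun i => polySeries (Q i)) = Z i)
    (hQF : ∀ i, comp (polySeries (Q i)) (fun i => polySeries (F i)) = Z i) (i : Fin n) :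
    compInverse .polynomial (fun i => polySeries (F i)) i = polySeries (Q i) := by
  have h : IsCompInverse .polynomial (fun i => polySeries (F i))
      (compInverse .polynomial (fun i => polySeries (F i))) :=
    Classical.epsilon_spec (p := IsCompInverse .polynomial _)
      ⟨fun i => polySeries (Q i), fun i => isPolynomial_polySeries _, hQF⟩
  exact polySeries_eq_of_comp_eq hFQ (h.1 i) (isPolynomial_polySeries _)
    ((h.2 i).trans (hQF i).symm)

end Inverse

theorem PropertyA.isMultiplier_and_hasTupleEval {f : Fin n → NCSeries n} (hf : PropertyA f) :
    (∀ i, IsMultiplier (compInverse .polynomial f i) (mulZ .polynomial f i)) ∧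
      HasTupleEval f (mulZ .polynomial f) lshift := by
  obtain ⟨hf, q, hq, hfq, hqf⟩ := hf
  choose F hF using fun i => (hf i).exists_polySeries
  choose Q hQ using fun i => (hq i).exists_polySeries
  obtain rfl : (fun i => polySeries (F i)) = f := funext hF
  obtain rfl : (fun i => polySeries (Q i)) = q := funext hQ
  constructor
  · intro i
    rw [compInverse_polynomial_eq hfq hqf, mulZ_polynomial_eq hfq hqf]
    exact ⟨fun β => rfl, shiftEval_comp_rshift (Q i)⟩
  · have : mulZ .polynomial (fun i => polySeries (F i)) = fun i => shiftEval (Q i) :=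
      funext (mulZ_polynomial_eq hfq hqf)
    rw [this]
    refine .inl fun j => ?_
    rw [← lift_shiftEval_of_comp_eq hfq j]
    exact hasSOTEval_polySeries _ _

end Polynomial

/-! ### The three cases combined -/

theorem HasModelProperty.isMultiplier {n : ℕ} {c : ModelClass} {f : Fin n → NCSeries n}
    (hf : HasModelProperty c f) (i : Fin n) : IsMultiplier (compInverse c f i) (mulZ c f i) := by
  cases c with
  | polynomial => exact (PropertyA.isMultiplier_and_hasTupleEval hf).1 i
  | powerSeries => exact PropertyS.isMultiplier hf i
  | freeHolomorphic γ => exact PropertyF.isMultiplier hf i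

theorem HasModelProperty.hasTupleEval {n : ℕ} {c : ModelClass} {f : Fin n → NCSeries n}
    (hf : HasModelProperty c f) : HasTupleEval f (mulZ c f) lshift := by
  cases c with
  | polynomial => exact (PropertyA.isMultiplier_and_hasTupleEval hf).2
  | powerSeries => exact PropertyS.hasTupleEval hf
  | freeHolomorphic γ => exact PropertyF.hasTupleEval hf

end NCModel

end

theorem mainTheorem1 {n : ℕ} (hn : 1 ≤ n) (c : NCModel.ModelClass)
    (f : Fin n → NCModel.NCSeries n) (hf : NCModel.HasModelProperty c f)
    {H : Type u} [NormedAddCommGroup H] [InnerProductSpace ℂ H] [CompleteSpace H]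
    (T : Fin n → H →L[ℂ] H) :
    (NCModel.IsPureElement c f T ↔
      ∃ (D : Type u) (_ : NormedAddCommGroup D) (_ : InnerProductSpace ℂ D)
        (_ : CompleteSpace D)
        (M : ClosedSubmodule ℂ (NCModel.HilbertTensor (NCModel.HardySpace f) D)),
        NCModel.IsCoinvariant M (fun i => NCModel.ampliation D (NCModel.mulZ c f i)) ∧
        NCModel.UnitarilyEquivalent T
          (fun i => NCModel.compression M (NCModel.ampliation D (NCModel.mulZ c f i)))) ∧
    (∀ Y : Fin n → H →L[ℂ] H, NCModel.IsDomainElement c f T Y → NCModel.IsPureRow Y →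
      ∃ K : H →ₗᵢ[ℂ]
          NCModel.HilbertTensor (NCModel.HardySpace f) (NCModel.defectSpace Y),
        NCModel.IsPoissonKernel f Y K ∧
        ∀ i h, K (ContinuousLinearMap.adjoint (T i) h) =
          ContinuousLinearMap.adjoint
            (NCModel.ampliation (NCModel.defectSpace Y) (NCModel.mulZ c f i)) (K h)) :=
  NCModel.model_theorem_of_isMultiplier c f hf.isMultiplier hf.hasTupleEval T
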